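/- For integers $d\ge 3$ and $p\ge 2$, call a real tensor $T=(T_{i_1,\dots,i_d})\in\mathbb R^{p^d}$ symmetric if its entries are invariant under permutations of the indices, and define its spectral norm by $$\|T\|_s=\sup_{x\in\mathbb R^p,\ \|x\|_2=1}\bigl|\langle T,x^{\otimes d}\rangle\bigr| .$$ A function $f:\mathbb R^{p^d}\to[0,\infty)$ is called a degree-$D$ low-degree polynomial algorithm if $f(T)=\varphi(P(T))$ for all $T\in\mathbb R^{p^d}$, where $P$ is a real polynomial of total degree at most $D$ in the entries of $T$ and $\varphi:\mathbb R\to[0,\infty)$ is nondecreasing. (In particular, $f$ may be a nonnegative polynomial of degree at most $D$, or a root of one.) We say that $f$ approximates the spectral norm with distortion $\gamma_f\ge 1$ if one of the following holds for all symmetric $T\in\mathbb R^{p^d}$: (i) (two-sided approximation) $\rho_f^{-1}\|T\|_s\le f(T)\le \zeta_f\|T\|_s$, where $\rho_f,\zeta_f\ge 1$ are constants not depending on $T$ and $\gamma_f=\rho_f\zeta_f$; (ii) (lower certificate) $\gamma_f^{-1}\|T\|_s\le f(T)\le \|T\|_s$; (iii) (upper certificate) $\|T\|_s\le f(T)\le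 \gamma_f\|T\|_s$. **Theorem.** For every $d\ge 3$ there are constants $c_d, C_d, K_d>0$ depending only on $d$ such that, for every $p\ge 2$, every integer $D\ge 0$ with $D\le c_d(\log p)^2$, and every degree-$D$ low-degree polynomial algorithm $f:\mathbb R^{p^d}\to[0,\infty)$ that approximates the spectral norm with distortion $\gamma_f$ in the sense of (i), (ii) or (iii), $$\gamma_f\ \ge\ K_d\,\frac{p^{d/4-1/2}}{(\log p)^{C_d}} .$$ -/

import Mathlib

open scoped NNReal

/-- Real tensors of order `d` and dimension `p` in every mode. -/
abbrev Tensor (d p : ℕ) : Type := (Fin d → Fin p) → ℝ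

/-- A tensor is symmetric if its entries are invariant under permutation of the `d` indices. -/
def Tensor.IsSymmetric {d p : ℕ} (T : Tensor d p) : Prop :=
  ∀ (π : Equiv.Perm (Fin d)) (i : Fin d → Fin p), T (fun j => i (π j)) = T i

/-- The pairing `⟨T, x^{⊗ d}⟩`. -/
noncomputable def Tensor.pairPow {d p : ℕ} (T : Tensor d p) (x : EuclideanSpace ℝ (Fin p)) : ℝ :=
  ∑ i : Fin d → Fin p, T i * ∏ j : Fin d, x (i j)

/-- The spectral norm `sup_{‖x‖₂ = 1} |⟨T, x^{⊗ d}⟩|` of a symmetric tensor. For odd `d` the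
absolute value makes no difference (replace `x` by `-x`); for even `d` it is what makes this
a norm. -/
noncomputable def Tensor.specNorm {d p : ℕ} (T : Tensor d p) : ℝ :=
  ⨆ x : Metric.sphere (0 : EuclideanSpace ℝ (Fin p)) 1, |T.pairPow (x : EuclideanSpace ℝ (Fin p))|

/-- `f` is a degree-`D` low-degree polynomial algorithm: its output is a real polynomial of total
degree at most `D` in the entries of the input, up to a nondecreasing post-processing `φ` of the
value. A nonnegative polynomial of degree at most `D` is the case `φ = Real.toNNReal`; the
Frobenius norm (`D = 2`) and roots of nonnegative polynomials are further examples. Every test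
`f T > τ` is a test that thresholds a polynomial of degree at most `D`. -/
def IsLowDegreeAlgorithm {d p : ℕ} (D : ℕ) (f : Tensor d p → ℝ≥0) : Prop :=
  ∃ P : MvPolynomial (Fin d → Fin p) ℝ, P.totalDegree ≤ D ∧
    ∃ φ : ℝ → ℝ≥0, Monotone φ ∧ ∀ T : Tensor d p, f T = φ (MvPolynomial.eval T P)

/-- Two-sided approximation of the spectral norm, with ratios `ρ, ζ ≥ 1` and distortion
`γ = ρ ζ`. -/
def IsTwoSidedApprox {d p : ℕ} (f : Tensor d p → ℝ≥0) (γ : ℝ) : Prop :=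
  ∃ ρ ζ : ℝ, 1 ≤ ρ ∧ 1 ≤ ζ ∧ γ = ρ * ζ ∧
    ∀ T : Tensor d p, T.IsSymmetric →
      ρ⁻¹ * T.specNorm ≤ (f T : ℝ) ∧ (f T : ℝ) ≤ ζ * T.specNorm

/-- Lower certificate for the spectral norm with distortion `γ ≥ 1`. -/
def IsLowerCertificate {d p : ℕ} (f : Tensor d p → ℝ≥0) (γ : ℝ) : Prop :=
  1 ≤ γ ∧ ∀ T : Tensor d p, T.IsSymmetric →
    γ⁻¹ * T.specNorm ≤ (f T : ℝ) ∧ (f T : ℝ) ≤ T.specNorm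

/-- Upper certificate for the spectral norm with distortion `γ ≥ 1`. -/
def IsUpperCertificate {d p : ℕ} (f : Tensor d p → ℝ≥0) (γ : ℝ) : Prop :=
  1 ≤ γ ∧ ∀ T : Tensor d p, T.IsSymmetric →
    T.specNorm ≤ (f T : ℝ) ∧ (f T : ℝ) ≤ γ * T.specNorm

/-! The lower bound comes from two coupled random sign tensors. The base tensor has uniform
independent signs; the planted one overwrites each entry, independently with probability `δ`, by the
corresponding entry of `x^{⊗ d}` for a uniform sign vector `x`. A net argument bounds the spectral
norm of the base tensor by about `√p log p`, while pairing the planted tensor with `x / √p` gives at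
least `δ p^{d/2} / 2`, both with overwhelming probability. Symmetrizing changes neither pairing.

Suppose a polynomial `P` of degree at most `D` took strictly larger values on all tensors of large
norm than on all those of small norm. Subtracting its maximum over the good base tensors gives a
multilinear polynomial `q` on signs with `q(base) ≤ 0` and `q(planted) > 0` off rare events. So
`E[q(base) q(planted)]` is at most the probability of the rare events times a crude sup bound `(p^d
+ 1)^D ∑ q_S²` (`multilin_sq_le`).

The coupling shares most entries, so the same correlation is at least `¼ ∑ q_S²` (`correlation_ge`):
the diagonal Fourier terms dominate as long as the moments of `x^{⊗ d}`, weighted by powers of about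
`D δ²`, are summable. Those moments are controlled by `E (∑ x_j)^{dk}`, of order `(dk)! p^{dk/2}`,
so `δ` may be as large as `p^{-d/4}` up to logarithms. The two bounds contradict each other
(`not_separates`).

Hence some small-norm tensor has a `P`-value at least that of some large-norm one. Monotone
post-processing preserves this, and the distortion is at least the ratio of norms, `p^{d/4} /
p^{1/2}` up to logarithms. -/

/-- Expectation of `g` when the coordinates are independent, each with weights `w`. -/
noncomputable def prodAvg {I κ : Type*} [Fintype I] [DecidableEq I] [Fintype κ] (w : κ → ℝ)
    (g : (I → κ) → ℝ) : ℝ :=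
  ∑ ω : I → κ, (∏ i, w (ω i)) * g ω

/-! ### Averages over finite product measures. -/

section prodAvg

variable {I κ : Type*} [Fintype I] [DecidableEq I] [Fintype κ] {w : κ → ℝ}

theorem prodAvg_prod (w : κ → ℝ) (h : I → κ → ℝ) :
    prodAvg w (fun ω : I → κ => ∏ i, h i (ω i)) = ∏ i, ∑ k, w k * h i k := by
  classical
  simp only [prodAvg, ← Finset.prod_mul_distrib]
  rw [Finset.prod_univ_sum, Fintype.piFinset_univ]

theorem prodAvg_const (hw : ∑ k, w k = 1) (c : ℝ) :
    prodAvg w (fun _ : I → κ => c) = c := by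
  have h := prodAvg_prod (I := I) w (fun _ _ => (1 : ℝ))
  simp only [Finset.prod_const_one, mul_one, hw] at h
  simp only [prodAvg, mul_one] at h
  rw [prodAvg, ← Finset.sum_mul, h, one_mul]

theorem prodAvg_mono (hw : ∀ k, 0 ≤ w k) {g h : (I → κ) → ℝ} (hgh : ∀ ω, g ω ≤ h ω) :
    prodAvg w g ≤ prodAvg w h :=
  Finset.sum_le_sum fun ω _ =>
    mul_le_mul_of_nonneg_left (hgh ω) (Finset.prod_nonneg fun i _ => hw (ω i))

theorem prodAvg_const_mul (c : ℝ) (g : (I → κ) → ℝ) :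
    prodAvg w (fun ω => c * g ω) = c * prodAvg w g := by
  simp only [prodAvg, Finset.mul_sum]
  exact Finset.sum_congr rfl fun ω _ => by ring

theorem prodAvg_add (g h : (I → κ) → ℝ) :
    prodAvg w (fun ω => g ω + h ω) = prodAvg w g + prodAvg w h := by
  simp only [prodAvg, mul_add, Finset.sum_add_distrib]

theorem prodAvg_sum {β : Type*} (s : Finset β) (g : β → (I → κ) → ℝ) :
    prodAvg w (fun ω => ∑ b ∈ s, g b ω) = ∑ b ∈ s, prodAvg w (g b) := by
  simp only [prodAvg, Finset.mul_sum]
  rw [Finset.sum_comm]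

open Classical in
/-- Chernoff's bound. -/
theorem prodAvg_chernoff (hw : ∀ k, 0 ≤ w k) {r : ℝ} (hr : 0 ≤ r) (t : ℝ)
    (Z : (I → κ) → ℝ) :
    prodAvg w (fun ω => if t ≤ Z ω then 1 else 0) ≤
      Real.exp (-(r * t)) * prodAvg w (fun ω => Real.exp (r * Z ω)) := by
  rw [← prodAvg_const_mul]
  refine prodAvg_mono hw fun ω => ?_
  rw [← Real.exp_add]
  split_ifs with h
  · have := mul_le_mul_of_nonneg_left h hr
    exact Real.one_le_exp (by linarith)
  · positivity

theorem prodAvg_exp_sum (w : κ → ℝ) (h : I → κ → ℝ) :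
    prodAvg w (fun ω : I → κ => Real.exp (∑ i, h i (ω i))) =
      ∏ i, ∑ k, w k * Real.exp (h i k) := by
  simp only [Real.exp_sum]
  exact prodAvg_prod w fun i k => Real.exp (h i k)

end prodAvg

/-! ### Multilinear functions of signs -/

/-- The multilinear polynomial with coefficients `q`. -/
noncomputable def multilin {I : Type*} [Fintype I] (q : Finset I → ℝ)
    (v : I → ℝ) : ℝ :=
  ∑ S : Finset I, q S * ∏ i ∈ S, v i

/-- All entries are `1` or `-1`. -/
def IsSign {I : Type*} (v : I → ℝ) : Prop := ∀ i, v i = 1 ∨ v i = -1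

theorem IsSign.mul_self {I : Type*} {v : I → ℝ} (hv : IsSign v) (i : I) : v i * v i = 1 := by
  rcases hv i with h | h <;> simp [h]

theorem IsSign.abs {I : Type*} {v : I → ℝ} (hv : IsSign v) (i : I) : |v i| = 1 := by
  rcases hv i with h | h <;> simp [h]

theorem IsSign.abs_prod {I : Type*} {v : I → ℝ} (hv : IsSign v) (S : Finset I) :
    |∏ i ∈ S, v i| = 1 := by
  rw [Finset.abs_prod]
  exact Finset.prod_eq_one fun i _ => hv.abs i

/-- On signs, `F` is a multilinear polynomial of degree at most `k`. -/
def IsLowDegreeOnSigns {I : Type*} [Fintype I] (k : ℕ) (F : (I → ℝ) → ℝ) : Prop :=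
  ∃ q : Finset I → ℝ, (∀ S, k < S.card → q S = 0) ∧ ∀ v, IsSign v → F v = multilin q v

section lowDegree

variable {I : Type*} [Fintype I] {k : ℕ} {F G : (I → ℝ) → ℝ}

theorem IsLowDegreeOnSigns.add (hF : IsLowDegreeOnSigns k F) (hG : IsLowDegreeOnSigns k G) :
    IsLowDegreeOnSigns k (fun v => F v + G v) := by
  obtain ⟨q, hq, hq'⟩ := hF
  obtain ⟨r, hr, hr'⟩ := hG
  refine ⟨fun S => q S + r S, fun S hS => by simp [hq S hS, hr S hS], fun v hv => ?_⟩
  simp only [multilin, add_mul, Finset.sum_add_distrib, hq' v hv, hr' v hv]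

theorem IsLowDegreeOnSigns.const_mul (c : ℝ) (hF : IsLowDegreeOnSigns k F) :
    IsLowDegreeOnSigns k (fun v => c * F v) := by
  obtain ⟨q, hq, hq'⟩ := hF
  refine ⟨fun S => c * q S, fun S hS => by simp [hq S hS], fun v hv => ?_⟩
  simp only [multilin, hq' v hv, Finset.mul_sum, mul_assoc]

theorem IsLowDegreeOnSigns.mono {l : ℕ} (h : k ≤ l) (hF : IsLowDegreeOnSigns k F) :
    IsLowDegreeOnSigns l F := by
  obtain ⟨q, hq, hq'⟩ := hF
  exact ⟨q, fun S hS => hq S (h.trans_lt hS), hq'⟩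

theorem isLowDegreeOnSigns_const (c : ℝ) :
    IsLowDegreeOnSigns k (fun _ : I → ℝ => c) := by
  classical
  refine ⟨fun S => if S = ∅ then c else 0, fun S hS => ?_, fun v _ => ?_⟩
  · have : S ≠ ∅ := by rintro rfl; simp at hS
    simp [this]
  · simp [multilin]

theorem IsLowDegreeOnSigns.sum {β : Type*} (s : Finset β) {F : β → (I → ℝ) → ℝ}
    (hF : ∀ b ∈ s, IsLowDegreeOnSigns k (F b)) :
    IsLowDegreeOnSigns k (fun v => ∑ b ∈ s, F b v) := by
  classical
  induction s using Finset.induction_on with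
  | empty => simpa using isLowDegreeOnSigns_const (I := I) (k := k) 0
  | insert a s ha ih =>
    simp only [Finset.sum_insert ha]
    exact (hF a (by simp)).add (ih fun b hb => hF b (by simp [hb]))

omit [Fintype I] in
theorem prod_symmDiff_singleton [DecidableEq I] {v : I → ℝ} (hv : IsSign v) (S : Finset I)
    (j : I) : ∏ i ∈ symmDiff S {j}, v i = (∏ i ∈ S, v i) * v j := by
  by_cases hj : j ∈ S
  · have h : symmDiff S {j} = S.erase j := by
      ext i; simp only [Finset.mem_symmDiff, Finset.mem_singleton, Finset.mem_erase]; grind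
    rw [h, ← Finset.prod_erase_mul S v hj, mul_assoc, hv.mul_self, mul_one]
  · have h : symmDiff S {j} = insert j S := by
      ext i; simp only [Finset.mem_symmDiff, Finset.mem_singleton, Finset.mem_insert]; grind
    rw [h, Finset.prod_insert hj, mul_comm]

/-- Since `v_j² = 1`, multiplying by `v_j` permutes monomials through the involution `S ↦ S ∆ {j}`,
which changes the degree by one. -/
theorem IsLowDegreeOnSigns.mul_coord (hF : IsLowDegreeOnSigns k F) (j : I) :
    IsLowDegreeOnSigns (k + 1) (fun v => F v * v j) := by
  classical
  obtain ⟨q, hq, hq'⟩ := hF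
  refine ⟨fun S => q (symmDiff S {j}), fun S hS => hq _ ?_, fun v hv => ?_⟩
  · have h1 : S ⊆ symmDiff S {j} ∪ {j} := by
      intro i hi
      simp only [Finset.mem_symmDiff, Finset.mem_singleton, Finset.mem_union]; grind
    have h2 := (Finset.card_le_card h1).trans (Finset.card_union_le _ _)
    simp only [Finset.card_singleton] at h2
    omega
  · simp only [hq' v hv, multilin, Finset.sum_mul]
    refine Finset.sum_bij' (fun S _ => symmDiff S {j}) (fun S _ => symmDiff S {j})
      (by simp) (by simp) (by simp) (by simp) fun S _ => ?_
    rw [symmDiff_symmDiff_cancel_right, prod_symmDiff_singleton hv, mul_assoc]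

theorem IsLowDegreeOnSigns.mul_linear (hF : IsLowDegreeOnSigns k F) (l : I → ℝ) :
    IsLowDegreeOnSigns (k + 1) (fun v => F v * ∑ j, l j * v j) := by
  have h := IsLowDegreeOnSigns.sum (Finset.univ : Finset I)
    (F := fun j v => l j * (F v * v j)) fun j _ => (hF.mul_coord j).const_mul (l j)
  simpa only [Finset.mul_sum, mul_left_comm] using h

theorem isLowDegreeOnSigns_eval {σ : Type*} (P : MvPolynomial σ ℝ) {D : ℕ}
    (hP : P.totalDegree ≤ D) (l : σ → I → ℝ) :
    IsLowDegreeOnSigns D (fun v => MvPolynomial.eval (fun i => ∑ j, l i j * v j) P) := by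
  classical
  have key : ∀ M : Multiset σ,
      IsLowDegreeOnSigns M.card (fun v => (M.map fun i => ∑ j, l i j * v j).prod) := by
    intro M
    induction M using Multiset.induction_on with
    | empty => simpa using isLowDegreeOnSigns_const (I := I) (k := 0) 1
    | cons a M ih =>
      simp only [Multiset.map_cons, Multiset.prod_cons, Multiset.card_cons]
      simpa only [mul_comm] using ih.mul_linear (l a)
  have h := IsLowDegreeOnSigns.sum P.support
    (F := fun m v => P.coeff m * ((Finsupp.toMultiset m).map fun i => ∑ j, l i j * v j).prod)
    (k := D) fun m hm => ((key _).mono ?_).const_mul _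
  · convert h using 2 with v
    rw [MvPolynomial.eval_eq]
    refine Finset.sum_congr rfl fun m _ => ?_
    rw [Finsupp.toMultiset_map, Finsupp.prod_toMultiset, Finsupp.prod_mapDomain_index (by simp)
      (by intros; rw [pow_add])]
    rfl
  · rw [Finsupp.card_toMultiset]
    exact (MvPolynomial.le_totalDegree hm).trans hP

/-- Both values are bounded by the `ℓ¹` norm of the coefficients; Cauchy–Schwarz over the monomials
of degree at most `D` turns it into the `ℓ²` norm. This crude bound suffices because the bad events
are exponentially rare. -/
theorem multilin_sq_le (q : Finset I → ℝ) {D : ℕ} (hq : ∀ S, D < S.card → q S = 0)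
    {u v : I → ℝ} (hu : IsSign u) (hv : IsSign v) :
    |multilin q u| * |multilin q v| ≤ ((Fintype.card I : ℝ) + 1) ^ D * ∑ S, q S ^ 2 := by
  classical
  have habs : ∀ v : I → ℝ, IsSign v → |multilin q v| ≤ ∑ S, |q S| := by
    intro v hv
    refine (Finset.abs_sum_le_sum_abs _ _).trans (Finset.sum_le_sum fun S _ => ?_)
    rw [abs_mul, hv.abs_prod, mul_one]
  have hsum : ∑ S, |q S| = ∑ S with S.card ≤ D, |q S| := by
    rw [Finset.sum_filter]
    refine Finset.sum_congr rfl fun S _ => ?_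
    split_ifs with h
    · rfl
    · rw [hq S (by omega), abs_zero]
  have hcard : ((Finset.univ.filter fun S : Finset I => S.card ≤ D).card : ℝ) ≤
      ((Fintype.card I : ℝ) + 1) ^ D := by
    have h1 : (Finset.univ.filter fun S : Finset I => S.card ≤ D) =
        (Finset.range (D + 1)).biUnion fun k => Finset.powersetCard k Finset.univ := by
      ext S; simp
    have h2 : (Finset.univ.filter fun S : Finset I => S.card ≤ D).card ≤
        (Fintype.card I + 1) ^ D := by
      rw [h1]
      refine Finset.card_biUnion_le.trans ?_
      -- The number of `k`-subsets is at most the `k`-th term of the binomial expansion of `(|I| +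
      -- 1)^D`.
      rw [add_pow]
      refine Finset.sum_le_sum fun k hk => ?_
      rw [Finset.card_powersetCard, Finset.card_univ, one_pow, mul_one]
      have h3 : 1 ≤ D.choose k :=
        Nat.choose_pos (by simpa [Nat.lt_succ_iff] using hk)
      calc (Fintype.card I).choose k ≤ Fintype.card I ^ k := Nat.choose_le_pow _ _
        _ ≤ Fintype.card I ^ k * D.choose k := Nat.le_mul_of_pos_right _ h3
    exact_mod_cast h2
  calc |multilin q u| * |multilin q v| ≤ (∑ S, |q S|) * (∑ S, |q S|) :=
        mul_le_mul (habs u hu) (habs v hv) (abs_nonneg _)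
          (Finset.sum_nonneg fun _ _ => abs_nonneg _)
    _ = (∑ S with S.card ≤ D, |q S|) ^ 2 := by rw [hsum, sq]
    _ ≤ (Finset.univ.filter fun S : Finset I => S.card ≤ D).card *
          ∑ S with S.card ≤ D, |q S| ^ 2 := sq_sum_le_card_mul_sum_sq
    _ ≤ ((Fintype.card I : ℝ) + 1) ^ D * ∑ S, q S ^ 2 := by
        refine mul_le_mul hcard ?_ (Finset.sum_nonneg fun _ _ => by positivity) (by positivity)
        simp only [sq_abs]
        exact Finset.sum_le_sum_of_subset_of_nonneg (Finset.filter_subset _ _)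
          fun _ _ _ => sq_nonneg _

end lowDegree

/-! ### The planted pair of sign vectors -/

/-- The sign encoded by a Boolean. -/
noncomputable def boolSign (b : Bool) : ℝ := if b then 1 else -1

/-- A uniform sign together with an independent flag of probability `δ`. -/
noncomputable def flagWeight (δ : ℝ) (k : Bool × Bool) : ℝ := 1 / 2 * if k.2 then δ else 1 - δ

/-- The weights of a uniform sign. -/
noncomputable def coinWeight (_ : Bool) : ℝ := 1 / 2

/-- The unplanted signs. -/
noncomputable def baseSign {I : Type*} (ω : I → Bool × Bool) (i : I) : ℝ := boolSign (ω i).1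

/-- The signs obtained by overwriting the flagged entries with `s`. -/
noncomputable def plantSign {I : Type*} (s : I → ℝ) (ω : I → Bool × Bool) (i : I) : ℝ :=
  if (ω i).2 then s i else boolSign (ω i).1

theorem boolSign_eq (b : Bool) : boolSign b = 1 ∨ boolSign b = -1 := by
  cases b <;> simp [boolSign]

theorem isSign_baseSign {I : Type*} (ω : I → Bool × Bool) : IsSign (baseSign ω) :=
  fun _ => boolSign_eq _

theorem isSign_plantSign {I : Type*} {s : I → ℝ} (hs : IsSign s) (ω : I → Bool × Bool) :
    IsSign (plantSign s ω) := by
  intro i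
  unfold plantSign
  split_ifs
  · exact hs i
  · exact boolSign_eq _

theorem flagWeight_nonneg {δ : ℝ} (h0 : 0 ≤ δ) (h1 : δ ≤ 1) (k : Bool × Bool) :
    0 ≤ flagWeight δ k := by
  unfold flagWeight
  split_ifs <;> linarith

theorem sum_flagWeight (δ : ℝ) : ∑ k, flagWeight δ k = 1 := by
  simp [flagWeight, Fintype.sum_prod_type]

theorem coinWeight_nonneg (b : Bool) : 0 ≤ coinWeight b := by norm_num [coinWeight]

theorem sum_coinWeight : ∑ k, coinWeight k = 1 := by norm_num [coinWeight]

/-! ### Correlation between a low-degree function of the base signs and of the planted signs. -/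

section correlation

variable {I J : Type*} [Fintype I] [DecidableEq I] [Fintype J] [DecidableEq J]

/-- The average factors over coordinates. An index in `V` only averages to zero; one in both sets
survives exactly when unflagged; one in `S` only survives exactly when flagged, leaving `s i`. -/
theorem prodAvg_base_mul_plant (δ : ℝ) (s : I → ℝ) (V S : Finset I) :
    prodAvg (flagWeight δ)
        (fun ω => (∏ i ∈ V, baseSign ω i) * ∏ i ∈ S, plantSign s ω i) =
      if V ⊆ S then (1 - δ) ^ V.card * δ ^ (S \ V).card * ∏ i ∈ S \ V, s i else 0 := by
  have h1 : ∀ ω : I → Bool × Bool,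
      (∏ i ∈ V, baseSign ω i) * ∏ i ∈ S, plantSign s ω i =
        ∏ i, ((if i ∈ V then boolSign (ω i).1 else 1) *
          (if i ∈ S then (if (ω i).2 then s i else boolSign (ω i).1) else 1)) := by
    intro ω
    rw [Finset.prod_mul_distrib, Finset.prod_ite_mem, Finset.prod_ite_mem, Finset.univ_inter,
      Finset.univ_inter]
    rfl
  simp only [h1]
  rw [prodAvg_prod (flagWeight δ) fun i k => (if i ∈ V then boolSign k.1 else 1) *
          (if i ∈ S then (if k.2 then s i else boolSign k.1) else 1)]
  have h2 : ∀ i, ∑ k : Bool × Bool, flagWeight δ k * ((if i ∈ V then boolSign k.1 else 1) *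
          (if i ∈ S then (if k.2 then s i else boolSign k.1) else 1)) =
        if i ∈ V then (if i ∈ S then 1 - δ else 0) else (if i ∈ S then δ * s i else 1) := by
    intro i
    by_cases hV : i ∈ V <;> by_cases hS : i ∈ S <;>
      simp [hV, hS, Fintype.sum_prod_type, flagWeight, boolSign] <;> ring
  simp only [h2]
  split_ifs with h
  · have h3 : ∀ i, (if i ∈ V then (if i ∈ S then 1 - δ else 0)
        else (if i ∈ S then δ * s i else 1)) =
        (if i ∈ V then 1 - δ else 1) * (if i ∈ S \ V then δ * s i else 1) := by
      intro i
      by_cases hV : i ∈ V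
      · simp [hV, h hV]
      · simp [hV]
    simp only [h3]
    rw [Finset.prod_mul_distrib, Finset.prod_ite_mem, Finset.prod_ite_mem, Finset.univ_inter,
      Finset.univ_inter, Finset.prod_const, Finset.prod_mul_distrib, Finset.prod_const, mul_assoc]
  · obtain ⟨i, hiV, hiS⟩ := Finset.not_subset.1 h
    exact Finset.prod_eq_zero (Finset.mem_univ i) (by simp [hiV, hiS])

/-- The moment `E ∏_{i ∈ U} s_i` of a random planted vector. -/
noncomputable def plantMoment (s : (J → Bool) → I → ℝ) (U : Finset I) : ℝ :=
  prodAvg coinWeight fun x => ∏ i ∈ U, s x i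

theorem correlation_eq (δ : ℝ) (s : (J → Bool) → I → ℝ) (q : Finset I → ℝ) :
    prodAvg coinWeight (fun x => prodAvg (flagWeight δ) fun ω =>
        multilin q (baseSign ω) * multilin q (plantSign (s x) ω)) =
      ∑ S, ∑ V ∈ S.powerset,
        q V * q S * ((1 - δ) ^ V.card * δ ^ (S \ V).card * plantMoment s (S \ V)) := by
  have h1 : ∀ x ω, multilin q (baseSign ω) * multilin q (plantSign (s x) ω) =
      ∑ S : Finset I, ∑ V : Finset I, (q V * q S) * ((∏ i ∈ V, baseSign ω i) *
        ∏ i ∈ S, plantSign (s x) ω i) := by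
    intro x ω
    rw [multilin, multilin, Finset.sum_mul_sum, Finset.sum_comm]
    exact Finset.sum_congr rfl fun S _ => Finset.sum_congr rfl fun V _ => by ring
  simp only [h1, prodAvg_sum, prodAvg_const_mul, prodAvg_base_mul_plant]
  refine Finset.sum_congr rfl fun S _ => ?_
  have h2 : S.powerset = Finset.univ.filter fun V => V ⊆ S := by ext; simp
  rw [h2, Finset.sum_filter]
  refine Finset.sum_congr rfl fun V _ => ?_
  split_ifs with h
  · rw [prodAvg_const_mul]; rfl
  · rw [prodAvg_const sum_coinWeight, mul_zero]

/-- The quadratic form is diagonally dominant. Terms `V = S` have weight at least `3/4`;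
off-diagonal ones are split by a weighted AM–GM inequality, with `α` balancing the sum over `V ⊆ S`
(binomial, `hα1`) against the sum over `S ⊇ V` (moments, `hα2`). -/
theorem correlation_ge {δ α : ℝ} {D : ℕ} {m : Finset I → ℝ} {q : Finset I → ℝ}
    (hδ0 : 0 ≤ δ) (hδ1 : δ ≤ 1) (hα : 0 < α) (hm0 : ∀ U, 0 ≤ m U) (hm1 : ∀ U, m U ≤ 1)
    (hm : m ∅ = 1) (hq : ∀ S, D < S.card → q S = 0) (hδD : δ * D ≤ 1 / 4)
    (hα1 : (1 + δ / α) ^ D ≤ 4 / 3)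
    (hα2 : ∑ U with U ≠ ∅ ∧ U.card ≤ D, (δ * α) ^ U.card * m U ≤ 1 / 3) :
    1 / 4 * ∑ S, q S ^ 2 ≤ ∑ S, ∑ V ∈ S.powerset,
        q V * q S * ((1 - δ) ^ V.card * δ ^ (S \ V).card * m (S \ V)) := by
  have hdiag : ∀ S : Finset I, S.card ≤ D → 3 / 4 ≤ (1 - δ) ^ S.card := by
    intro S hS
    have h1 := one_add_mul_le_pow (a := -δ) (by linarith) S.card
    have h2 : (S.card : ℝ) * δ ≤ D * δ := by
      gcongr
    rw [sub_eq_add_neg]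
    linarith
  -- AM–GM with weight `α^k`, `k = |S \ V|`. The moment is kept on the `q V` side, where it is
  -- needed for summability over `S`, and bounded by `1` on the `q S` side.
  have hoff : ∀ S V : Finset I,
      -(1 / 2 * ((δ * α) ^ (S \ V).card * m (S \ V) * q V ^ 2 +
          (δ / α) ^ (S \ V).card * q S ^ 2)) ≤
        q V * q S * ((1 - δ) ^ V.card * δ ^ (S \ V).card * m (S \ V)) := by
    intro S V
    set k := (S \ V).card
    set a := (1 - δ) ^ V.card with ha
    set u := m (S \ V)
    have ha0 : 0 ≤ a := pow_nonneg (by linarith) _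
    have ha1 : a ≤ 1 := pow_le_one₀ (by linarith) (by linarith)
    have hu0 : 0 ≤ u := hm0 _
    have hu1 : u ≤ 1 := hm1 _
    have hd : 0 ≤ δ ^ k := pow_nonneg hδ0 _
    have hA : 0 < α ^ k := pow_pos hα _
    rw [mul_pow, div_pow]
    have h1 : -(1 / 2 * (α ^ k * q V ^ 2 + q S ^ 2 / α ^ k)) ≤ -|q V * q S| := by
      rw [neg_le_neg_iff, abs_mul]
      have h3 : 0 ≤ (α ^ k * |q V| - |q S|) ^ 2 / α ^ k := by positivity
      have h4 : (α ^ k * |q V| - |q S|) ^ 2 / α ^ k =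
          α ^ k * q V ^ 2 + q S ^ 2 / α ^ k - 2 * (|q V| * |q S|) := by
        field_simp
        rw [← sq_abs (q V), ← sq_abs (q S)]
        ring
      linarith
    have h2 : -|q V * q S| * (δ ^ k * u) ≤ q V * q S * (a * δ ^ k * u) := by
      have h5 : -|q V * q S| ≤ q V * q S * a := by
        have := neg_abs_le (q V * q S * a)
        rw [abs_mul, abs_of_nonneg ha0] at this
        nlinarith [abs_nonneg (q V * q S)]
      calc -|q V * q S| * (δ ^ k * u) ≤ q V * q S * a * (δ ^ k * u) :=
            mul_le_mul_of_nonneg_right h5 (by positivity)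
        _ = _ := by ring
    have h6 := mul_le_mul_of_nonneg_right h1 (mul_nonneg hd hu0)
    have h7 : δ ^ k * u * (q S ^ 2 / α ^ k) ≤ δ ^ k / α ^ k * q S ^ 2 := by
      calc δ ^ k * u * (q S ^ 2 / α ^ k) ≤ δ ^ k * 1 * (q S ^ 2 / α ^ k) := by gcongr
        _ = _ := by ring
    nlinarith
  have hS : ∀ S : Finset I, S.card ≤ D → 3 / 4 * q S ^ 2 - 1 / 2 * (1 / 3 * q S ^ 2) -
      1 / 2 * ∑ V ∈ S.ssubsets, (δ * α) ^ (S \ V).card * m (S \ V) * q V ^ 2 ≤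
      ∑ V ∈ S.powerset, q V * q S * ((1 - δ) ^ V.card * δ ^ (S \ V).card * m (S \ V)) := by
    intro S hSD
    have h1 : ∑ V ∈ S.ssubsets, (δ / α) ^ (S \ V).card ≤ 1 / 3 := by
      have h2 := Finset.sum_pow_mul_eq_add_pow (1 : ℝ) (δ / α) S
      simp only [one_pow, one_mul] at h2
      have h3 : ∑ V ∈ S.powerset, (δ / α) ^ (S.card - V.card) =
          ∑ V ∈ S.powerset, (δ / α) ^ (S \ V).card :=
        Finset.sum_congr rfl fun V hV => by
          rw [Finset.card_sdiff_of_subset (Finset.mem_powerset.1 hV)]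
      rw [h3, ← Finset.sum_erase_add _ _ (Finset.mem_powerset_self S)] at h2
      simp only [sdiff_self, Finset.bot_eq_empty, Finset.card_empty, pow_zero] at h2
      have h4 : (1 + δ / α) ^ S.card ≤ (1 + δ / α) ^ D :=
        pow_le_pow_right₀ (by have : 0 ≤ δ / α := by positivity
                              linarith) hSD
      change ∑ V ∈ S.powerset.erase S, _ ≤ _
      linarith
    rw [← Finset.sum_erase_add _ _ (Finset.mem_powerset_self S)]
    have h5 : ∑ V ∈ S.ssubsets, -(1 / 2 * ((δ * α) ^ (S \ V).card * m (S \ V) * q V ^ 2 +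
          (δ / α) ^ (S \ V).card * q S ^ 2)) ≤ ∑ V ∈ S.powerset.erase S,
        q V * q S * ((1 - δ) ^ V.card * δ ^ (S \ V).card * m (S \ V)) :=
      Finset.sum_le_sum fun V _ => hoff S V
    rw [Finset.sum_neg_distrib, ← Finset.mul_sum, Finset.sum_add_distrib, ← Finset.sum_mul] at h5
    simp only [sdiff_self, Finset.bot_eq_empty, Finset.card_empty, pow_zero, hm, mul_one]
    have h6 := mul_le_mul_of_nonneg_right (hdiag S hSD) (sq_nonneg (q S))
    have h7 := mul_le_mul_of_nonneg_right h1 (sq_nonneg (q S))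
    nlinarith
  have hswap : ∑ S with S.card ≤ D, ∑ V ∈ S.ssubsets,
      (δ * α) ^ (S \ V).card * m (S \ V) * q V ^ 2 ≤ 1 / 3 * ∑ V, q V ^ 2 := by
    have h1 : ∑ S with S.card ≤ D, ∑ V ∈ S.ssubsets,
        (δ * α) ^ (S \ V).card * m (S \ V) * q V ^ 2 =
        ∑ V, ∑ S with V ⊂ S ∧ S.card ≤ D,
          (δ * α) ^ (S \ V).card * m (S \ V) * q V ^ 2 :=
      Finset.sum_comm' (by intro S V; simp; tauto)
    rw [h1, Finset.mul_sum]
    refine Finset.sum_le_sum fun V _ => ?_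
    rw [← Finset.sum_mul]
    refine mul_le_mul_of_nonneg_right (le_trans ?_ hα2) (sq_nonneg _)
    -- For fixed `V`, a superset `S` is determined by `U = S \ V`, so the inner sum is dominated by
    -- the sum over `U` in `hα2`.
    have hinj : Set.InjOn (fun S : Finset I => S \ V)
        (Finset.univ.filter fun S => V ⊂ S ∧ S.card ≤ D : Finset (Finset I)) := by
      intro S hS T hT h
      simp only [Finset.coe_filter, Finset.mem_univ, true_and, Set.mem_ofPred_eq] at hS hT
      rw [← Finset.sdiff_union_of_subset hS.1.subset, ← Finset.sdiff_union_of_subset hT.1.subset]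
      simp only at h
      rw [h]
    rw [← Finset.sum_image (f := fun U => (δ * α) ^ U.card * m U) hinj]
    refine Finset.sum_le_sum_of_subset_of_nonneg ?_ fun U _ _ =>
      mul_nonneg (pow_nonneg (by positivity) _) (hm0 U)
    intro U hU
    simp only [Finset.mem_image, Finset.mem_filter, Finset.mem_univ, true_and] at hU ⊢
    obtain ⟨S, ⟨hVS, hSD⟩, rfl⟩ := hU
    refine ⟨?_, (Finset.card_le_card Finset.sdiff_subset).trans hSD⟩
    rw [Ne, Finset.sdiff_eq_empty_iff_subset]
    exact hVS.not_subset
  have hsq : ∑ S with S.card ≤ D, q S ^ 2 = ∑ S, q S ^ 2 := by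
    rw [Finset.sum_filter]
    refine Finset.sum_congr rfl fun S _ => ?_
    split_ifs with h
    · rfl
    · rw [hq S (by omega)]; simp
  have hrestr : ∑ S with S.card ≤ D, ∑ V ∈ S.powerset,
        q V * q S * ((1 - δ) ^ V.card * δ ^ (S \ V).card * m (S \ V)) =
      ∑ S, ∑ V ∈ S.powerset,
        q V * q S * ((1 - δ) ^ V.card * δ ^ (S \ V).card * m (S \ V)) := by
    rw [Finset.sum_filter]
    refine Finset.sum_congr rfl fun S _ => ?_
    split_ifs with h
    · rfl
    · rw [hq S (by omega)]; simp
  have hfinal := Finset.sum_le_sum (s := Finset.univ.filter fun S : Finset I => S.card ≤ D) fun S hSm => hS S (Finset.mem_filter.1 hSm).2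
  rw [hrestr, Finset.sum_sub_distrib, Finset.sum_sub_distrib, ← Finset.mul_sum, ← Finset.mul_sum,
    ← Finset.mul_sum, ← Finset.mul_sum, hsq] at hfinal
  -- The bounds leave `3/4 - 1/6 - 1/6 = 5/12`, which exceeds `1/4`.
  have hnn : 0 ≤ ∑ S, q S ^ 2 := Finset.sum_nonneg fun _ _ => sq_nonneg _
  linarith

end correlation

/-! ### Moments of random rank-one sign tensors -/

/-- The rank-one tensor `x^{⊗ d}` of a sign vector. -/
noncomputable def rankOneSign {d p : ℕ} (x : Fin p → Bool) (i : Fin d → Fin p) : ℝ :=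
  ∏ j, boolSign (x (i j))

theorem isSign_prod {A J : Type*} (s : Finset A) {v : J → ℝ} (hv : IsSign v) (f : A → J) :
    (∏ a ∈ s, v (f a)) = 1 ∨ (∏ a ∈ s, v (f a)) = -1 := by
  have h : |∏ a ∈ s, v (f a)| = 1 := IsSign.abs_prod (fun a => hv (f a)) s
  exact eq_or_eq_neg_of_abs_eq h

theorem isSign_rankOneSign {d p : ℕ} (x : Fin p → Bool) :
    IsSign (rankOneSign x : (Fin d → Fin p) → ℝ) :=
  fun i => isSign_prod Finset.univ (v := fun j => boolSign (x j)) (fun _ => boolSign_eq _) i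

/-- Grouping equal coordinates leaves powers of independent signs: an even power averages to `1`, an
odd one to `0`. -/
theorem prodAvg_coin_prod_mem_Icc {A J : Type*} [Fintype J] [DecidableEq J] (s : Finset A)
    (f : A → J) :
    prodAvg coinWeight (fun x : J → Bool => ∏ a ∈ s, boolSign (x (f a))) ∈ Set.Icc (0 : ℝ) 1 := by
  classical
  have h1 : ∀ x : J → Bool, ∏ a ∈ s, boolSign (x (f a)) =
      ∏ j, boolSign (x j) ^ (s.filter fun a => f a = j).card := by
    intro x
    rw [← Finset.prod_fiberwise s f]
    refine Finset.prod_congr rfl fun j _ => ?_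
    rw [← Finset.prod_const]
    exact Finset.prod_congr rfl fun a ha => by rw [(Finset.mem_filter.1 ha).2]
  simp only [h1]
  rw [prodAvg_prod coinWeight fun j b => boolSign b ^ (s.filter fun a => f a = j).card]
  have h2 : ∀ n : ℕ, ∑ b, coinWeight b * boolSign b ^ n ∈ Set.Icc (0 : ℝ) 1 := by
    intro n
    rcases neg_one_pow_eq_or ℝ n with h | h <;> norm_num [coinWeight, boolSign, h]
  exact ⟨Finset.prod_nonneg fun j _ => (h2 _).1,
    Finset.prod_le_one (fun j _ => (h2 _).1) fun j _ => (h2 _).2⟩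

theorem prodAvg_rankOneSign_mem_Icc {A : Type*} {d p : ℕ} (s : Finset A)
    (t : A → Fin d → Fin p) :
    prodAvg coinWeight (fun x : Fin p → Bool => ∏ a ∈ s, rankOneSign x (t a)) ∈
      Set.Icc (0 : ℝ) 1 := by
  have h := prodAvg_coin_prod_mem_Icc (s ×ˢ (Finset.univ : Finset (Fin d)))
    fun a : A × Fin d => t a.1 a.2
  simpa only [Finset.prod_product, rankOneSign] using h

theorem plantMoment_empty {d p : ℕ} :
    plantMoment (rankOneSign : (Fin p → Bool) → (Fin d → Fin p) → ℝ) ∅ = 1 := by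
  simp only [plantMoment, Finset.prod_empty]
  exact prodAvg_const sum_coinWeight 1

theorem sum_rankOneSign {d p : ℕ} (x : Fin p → Bool) :
    ∑ i : Fin d → Fin p, rankOneSign x i = (∑ j, boolSign (x j)) ^ d :=
  (Fintype.sum_pow (fun j => boolSign (x j)) d).symm

/-- Expanding `(∑ x_j)^{dk}` gives a sum over `k`-tuples of multi-indices. Each `k`-set is
enumerated by one tuple, distinct sets by distinct tuples, and the remaining tuples contribute
nonnegative moments. -/
theorem sum_plantMoment_le {d p : ℕ} (k : ℕ) :
    ∑ U ∈ Finset.powersetCard k Finset.univ,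
        plantMoment (rankOneSign : (Fin p → Bool) → (Fin d → Fin p) → ℝ) U ≤
      prodAvg coinWeight fun x : Fin p → Bool => (∑ j, boolSign (x j)) ^ (d * k) := by
  classical
  have h1 : ∀ x : Fin p → Bool, (∑ j, boolSign (x j)) ^ (d * k) =
      ∑ t : Fin k → Fin d → Fin p, ∏ a, rankOneSign x (t a) := by
    intro x
    rw [pow_mul, ← sum_rankOneSign, Fintype.sum_pow]
  simp only [h1, prodAvg_sum]
  have h2 : ∀ U : {U // U ∈ Finset.powersetCard k (Finset.univ : Finset (Fin d → Fin p))},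
      ∃ t : Fin k → Fin d → Fin p, Function.Injective t ∧ Finset.univ.image t = U.1 := by
    rintro ⟨U, hU⟩
    have hk := (Finset.mem_powersetCard.1 hU).2
    refine ⟨fun a => ((U.equivFinOfCardEq hk).symm a : Fin d → Fin p), ?_, ?_⟩
    · exact Subtype.val_injective.comp (Equiv.injective _)
    · ext i
      simp only [Finset.mem_image, Finset.mem_univ, true_and]
      constructor
      · rintro ⟨a, rfl⟩
        exact Subtype.property _
      · intro hi
        exact ⟨U.equivFinOfCardEq hk ⟨i, hi⟩, by simp⟩
  choose e he1 he2 using h2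
  have he : Function.Injective e := fun U V h => Subtype.ext (by rw [← he2 U, ← he2 V, h])
  rw [← Finset.sum_attach]
  have h3 : ∀ U, plantMoment (rankOneSign : (Fin p → Bool) → (Fin d → Fin p) → ℝ) U.1 =
      prodAvg coinWeight fun x => ∏ a, rankOneSign x (e U a) := by
    intro U
    simp only [plantMoment]
    rw [← he2 U]
    simp only [Finset.prod_image fun a _ b _ h => he1 U h]
  simp only [h3]
  rw [← Finset.sum_image (f := fun t => prodAvg coinWeight fun x => ∏ a, rankOneSign x (t a))
    fun U _ V _ h => he h]
  exact Finset.sum_le_sum_of_subset_of_nonneg (Finset.subset_univ _)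
    fun t _ _ => (prodAvg_rankOneSign_mem_Icc Finset.univ t).1

/-- Apply `y^n / n! ≤ e^y` to `|∑ x_j| / √p`. Each of the two exponential moments is at most
`e^{1/2} ≤ 2`, whence the factor `4`. -/
theorem prodAvg_abs_pow_le {p : ℕ} (hp : 0 < p) (n : ℕ) :
    prodAvg coinWeight (fun x : Fin p → Bool => (∑ j, boolSign (x j)) ^ n) ≤
      4 * n.factorial * Real.sqrt p ^ n := by
  have hp' : (0 : ℝ) < Real.sqrt p := Real.sqrt_pos.2 (by exact_mod_cast hp)
  have hmgf : ∀ c : ℝ, c ^ 2 = (p : ℝ)⁻¹ →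
      prodAvg coinWeight (fun x : Fin p → Bool => Real.exp (c * ∑ j, boolSign (x j))) ≤ 2 := by
    intro c hc
    simp only [Finset.mul_sum]
    rw [prodAvg_exp_sum coinWeight fun _ b => c * boolSign b]
    have h1 : ∑ b, coinWeight b * Real.exp (c * boolSign b) = Real.cosh c := by
      simp [coinWeight, boolSign, Real.cosh_eq]; ring
    simp only [h1, Finset.prod_const, Finset.card_univ, Fintype.card_fin]
    calc Real.cosh c ^ p ≤ Real.exp (c ^ 2 / 2) ^ p :=
          pow_le_pow_left₀ (Real.cosh_pos c).le (Real.cosh_le_exp_half_sq c) _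
      _ = Real.exp (1 / 2) := by
          rw [← Real.exp_nat_mul, hc]
          congr 1
          field_simp
      _ ≤ 2 := by
          have h2 : Real.exp (1 / 2) ^ 2 = Real.exp 1 := by
            rw [← Real.exp_nat_mul]; norm_num
          nlinarith [Real.exp_one_lt_d9, Real.exp_pos (1 / 2)]
  set c := (Real.sqrt p)⁻¹ with hc
  have hc2 : c ^ 2 = (p : ℝ)⁻¹ := by rw [hc, inv_pow, Real.sq_sqrt (by positivity)]
  have h1 : ∀ x : Fin p → Bool, (∑ j, boolSign (x j)) ^ n ≤
      (n.factorial * Real.sqrt p ^ n) * (Real.exp (c * ∑ j, boolSign (x j)) +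
        Real.exp (-c * ∑ j, boolSign (x j))) := by
    intro x
    set Y := ∑ j, boolSign (x j)
    have h2 := Real.pow_div_factorial_le_exp (|c * Y|) (abs_nonneg _) n
    have h3 : Real.exp |c * Y| ≤ Real.exp (c * Y) + Real.exp (-c * Y) := by
      rcases abs_cases (c * Y) with h | h <;> rw [h.1]
      · linarith [Real.exp_pos (-c * Y)]
      · rw [neg_mul]; linarith [Real.exp_pos (c * Y)]
    have h4 : Y ^ n ≤ |Y| ^ n := by rw [← abs_pow]; exact le_abs_self _
    have h5 : |Y| ^ n = (n.factorial * Real.sqrt p ^ n) * (|c * Y| ^ n / n.factorial) := by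
      rw [abs_mul, abs_of_pos (inv_pos.2 hp'), mul_pow, inv_pow]
      have : (n.factorial : ℝ) ≠ 0 := by positivity
      field_simp
    rw [h5] at h4
    exact h4.trans (mul_le_mul_of_nonneg_left (h2.trans h3) (by positivity))
  refine (prodAvg_mono coinWeight_nonneg h1).trans ?_
  rw [prodAvg_const_mul, prodAvg_add]
  have h6 := hmgf c hc2
  have h7 := hmgf (-c) (by rw [neg_sq, hc2])
  have : (0 : ℝ) ≤ n.factorial * Real.sqrt p ^ n := by positivity
  nlinarith

/-! ### Tail bounds -/

section tails

variable {I : Type*} [Fintype I] [DecidableEq I]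

open Classical in
theorem baseSign_tail {δ : ℝ} (h0 : 0 ≤ δ) (h1 : δ ≤ 1) (c : I → ℝ) (hc : ∑ i, c i ^ 2 ≤ 1)
    {t : ℝ} (ht : 0 ≤ t) :
    prodAvg (flagWeight δ) (fun ω => if t ≤ ∑ i, c i * baseSign ω i then 1 else 0) ≤
      Real.exp (-(t ^ 2 / 2)) := by
  refine (prodAvg_chernoff (flagWeight_nonneg h0 h1) ht t _).trans ?_
  simp only [Finset.mul_sum]
  rw [show prodAvg (flagWeight δ)
      (fun ω : I → Bool × Bool => Real.exp (∑ i, t * (c i * baseSign ω i))) = _ from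
    prodAvg_exp_sum (flagWeight δ) fun i k => t * (c i * boolSign k.1)]
  have h2 : ∀ i, ∑ k, flagWeight δ k * Real.exp (t * (c i * boolSign k.1)) =
      Real.cosh (t * c i) := by
    intro i
    simp [flagWeight, boolSign, Real.cosh_eq, Fintype.sum_prod_type]; ring
  simp only [h2]
  calc Real.exp (-(t * t)) * ∏ i, Real.cosh (t * c i)
      ≤ Real.exp (-(t * t)) * ∏ i, Real.exp ((t * c i) ^ 2 / 2) := by
        gcongr with i
        exact Real.cosh_le_exp_half_sq _
    _ = Real.exp (-(t * t) + t ^ 2 / 2 * ∑ i, c i ^ 2) := by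
        rw [← Real.exp_sum, ← Real.exp_add, Finset.mul_sum]
        congr 2
        exact Finset.sum_congr rfl fun i _ => by ring
    _ ≤ Real.exp (-(t ^ 2 / 2)) := by
        rw [Real.exp_le_exp]
        nlinarith [sq_nonneg t]

open Classical in
theorem plantSign_tail {δ : ℝ} (h0 : 0 ≤ δ) (h1 : δ ≤ 1) {s : I → ℝ} (hs : IsSign s) :
    prodAvg (flagWeight δ) (fun ω =>
        if ∑ i, s i * plantSign s ω i ≤ δ * Fintype.card I / 2 then 1 else 0) ≤
      Real.exp (-(Fintype.card I * δ ^ 2 / 16)) := by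
  set N : ℝ := (Fintype.card I : ℝ) with hN
  -- Each entry has mean `δ` along `s`, so the exponent per entry is at most `-δr/2 + r²`; this `r`
  -- makes it `-δ²/16`.
  set r := δ / 4 with hr
  have hr0 : 0 ≤ r := by positivity
  have h2 := prodAvg_chernoff (flagWeight_nonneg h0 h1) hr0 (-(δ * N / 2))
    (fun ω => -∑ i, s i * plantSign s ω i)
  simp only [neg_le_neg_iff] at h2
  refine h2.trans ?_
  have h12 : ∀ ω : I → Bool × Bool, r * -∑ i, s i * plantSign s ω i =
      ∑ i, -r * (s i * plantSign s ω i) := fun ω => by rw [← Finset.mul_sum, mul_neg, neg_mul]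
  simp only [h12]
  rw [show prodAvg (flagWeight δ)
      (fun ω : I → Bool × Bool => Real.exp (∑ i, -r * (s i * plantSign s ω i))) = _ from
    prodAvg_exp_sum (flagWeight δ) fun i k => -r * (s i * if k.2 then s i else boolSign k.1)]
  have h3 : ∀ i, ∑ k : Bool × Bool, flagWeight δ k *
      Real.exp (-r * (s i * if k.2 then s i else boolSign k.1)) ≤ Real.exp (-δ * r + r ^ 2) := by
    intro i
    have h4 : ∑ k : Bool × Bool, flagWeight δ k *
      Real.exp (-r * (s i * if k.2 then s i else boolSign k.1)) =
        δ * Real.exp (-r) + (1 - δ) * Real.cosh r := by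
      rcases hs i with h | h <;>
        simp [flagWeight, boolSign, Real.cosh_eq, Fintype.sum_prod_type, h] <;> ring
    have h5 : Real.exp (-r) ≤ 1 - r + r ^ 2 := by
      have := (abs_le.1 (Real.abs_exp_sub_one_sub_id_le (x := -r)
        (by rw [abs_neg, abs_of_nonneg hr0]; linarith))).2
      nlinarith
    have h6 : Real.cosh r ≤ 1 + r ^ 2 := by
      have h7 := (abs_le.1 (Real.abs_exp_sub_one_sub_id_le (x := -r)
        (by rw [abs_neg, abs_of_nonneg hr0]; linarith))).2
      have h8 := (abs_le.1 (Real.abs_exp_sub_one_sub_id_le (x := r)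
        (by rw [abs_of_nonneg hr0]; linarith))).2
      rw [Real.cosh_eq]
      nlinarith
    rw [h4]
    have h9 := Real.add_one_le_exp (-δ * r + r ^ 2)
    have h10 := mul_le_mul_of_nonneg_left h5 h0
    have h11 := mul_le_mul_of_nonneg_left h6 (sub_nonneg.2 h1)
    nlinarith
  calc _ ≤ Real.exp (-(r * -(δ * N / 2))) * ∏ _i : I, Real.exp (-δ * r + r ^ 2) := by
        gcongr with i
        · intro i _
          exact Finset.sum_nonneg fun k _ =>
            mul_nonneg (flagWeight_nonneg h0 h1 k) (Real.exp_pos _).le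
        · exact h3 i
    _ = Real.exp (-(N * δ ^ 2 / 16)) := by
        rw [Finset.prod_const, Finset.card_univ, ← Real.exp_nat_mul, ← Real.exp_add, ← hN, hr]
        congr 1
        ring

end tails

/-! ### The spectral norm of a random sign tensor -/

theorem abs_prod_sub_prod_le {A : Type*} (s : Finset A) (f g : A → ℝ) (hf : ∀ a, |f a| ≤ 1)
    (hg : ∀ a, |g a| ≤ 1) : |∏ a ∈ s, f a - ∏ a ∈ s, g a| ≤ ∑ a ∈ s, |f a - g a| := by
  classical
  induction s using Finset.induction_on with
  | empty => simp
  | insert a s ha ih =>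
    rw [Finset.prod_insert ha, Finset.prod_insert ha, Finset.sum_insert ha]
    have h1 : f a * ∏ b ∈ s, f b - g a * ∏ b ∈ s, g b =
        (f a - g a) * ∏ b ∈ s, f b + g a * (∏ b ∈ s, f b - ∏ b ∈ s, g b) := by ring
    have h2 : |∏ b ∈ s, f b| ≤ 1 := by
      rw [Finset.abs_prod]
      exact Finset.prod_le_one (fun _ _ => abs_nonneg _) fun b _ => hf b
    rw [h1]
    refine (abs_add_le _ _).trans (add_le_add ?_ ?_)
    · rw [abs_mul]
      exact mul_le_of_le_one_right (abs_nonneg _) h2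
    · rw [abs_mul]
      exact (mul_le_of_le_one_left (abs_nonneg _) (hg a)).trans ih

/-- A grid point of mesh `1 / M` in `[-1, 1]`. -/
noncomputable def gridPoint (M : ℕ) (k : Fin (2 * M + 1)) : ℝ := ((k : ℝ) - M) / M

/-- Rounding is towards zero, so a rounded unit vector stays in the unit ball. -/
theorem exists_gridPoint {M : ℕ} (hM : 0 < M) {x : ℝ} (hx : |x| ≤ 1) :
    ∃ k, |gridPoint M k| ≤ |x| ∧ |x - gridPoint M k| ≤ 1 / M := by
  have hM' : (0 : ℝ) < M := by exact_mod_cast hM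
  set n := ⌊M * |x|⌋₊ with hn
  have h1 : (n : ℝ) ≤ M * |x| := Nat.floor_le (by positivity)
  have h2 : M * |x| < n + 1 := Nat.lt_floor_add_one _
  have h3 : n ≤ M := by
    have : (n : ℝ) ≤ M := h1.trans (mul_le_of_le_one_right hM'.le hx)
    exact_mod_cast this
  have h4 : (n : ℝ) / M ≤ |x| := by rw [div_le_iff₀ hM']; linarith
  have h5 : |x| - n / M ≤ 1 / M := by
    rw [sub_le_iff_le_add, ← add_div, le_div_iff₀ hM']; linarith
  rcases le_total 0 x with h | h
  · refine ⟨⟨M + n, by omega⟩, ?_⟩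
    have h6 : gridPoint M ⟨M + n, by omega⟩ = n / M := by simp [gridPoint]
    rw [abs_of_nonneg h] at h4 h5
    rw [h6, abs_of_nonneg h, abs_of_nonneg (by positivity), abs_of_nonneg (by linarith)]
    exact ⟨h4, h5⟩
  · refine ⟨⟨M - n, by omega⟩, ?_⟩
    have h6 : gridPoint M ⟨M - n, by omega⟩ = -(n / M) := by
      simp [gridPoint, Nat.cast_sub h3, neg_div]
    rw [abs_of_nonpos h] at h4 h5
    rw [h6, abs_neg, abs_of_nonpos h, abs_of_nonneg (by positivity), abs_of_nonpos (by linarith)]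
    exact ⟨h4, by linarith⟩

theorem sum_sq_prod {d p : ℕ} (y : Fin p → ℝ) :
    ∑ i : Fin d → Fin p, (∏ j, y (i j)) ^ 2 = (∑ j, y j ^ 2) ^ d := by
  rw [Fintype.sum_pow]
  simp only [Finset.prod_pow]

/-- With mesh `p^{-d}`, rounding changes each of the `p^d` products by at most `d p^{-d}`, hence the
pairing by at most `d`. -/
theorem exists_grid_of_pairPow {d p : ℕ} (hp : 0 < p) {A : Tensor d p} (hA : IsSign A)
    {t : ℝ} {x : EuclideanSpace ℝ (Fin p)} (hx : ‖x‖ = 1) (h : t + d ≤ |A.pairPow x|) :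
    ∃ k : Fin p → Fin (2 * p ^ d + 1), ∑ j, gridPoint (p ^ d) (k j) ^ 2 ≤ 1 ∧
      t ≤ |∑ i : Fin d → Fin p, (∏ j, gridPoint (p ^ d) (k (i j))) * A i| := by
  have hx2 : ∑ j, x j ^ 2 = 1 := by
    rw [← EuclideanSpace.real_norm_sq_eq, hx, one_pow]
  have hx1 : ∀ j, |x j| ≤ 1 := fun j => by
    rw [← sq_le_one_iff_abs_le_one, ← hx2]
    exact Finset.single_le_sum (f := fun j => x j ^ 2) (fun _ _ => sq_nonneg _) (Finset.mem_univ j)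
  have hM : 0 < p ^ d := pow_pos hp d
  choose k hk1 hk2 using fun j => exists_gridPoint hM (hx1 j)
  refine ⟨k, ?_, ?_⟩
  · rw [← hx2]
    exact Finset.sum_le_sum fun j _ => sq_le_sq.2 (hk1 j)
  · set y := fun j => gridPoint (p ^ d) (k j)
    have h1 : |A.pairPow x - ∑ i : Fin d → Fin p, (∏ j, y (i j)) * A i| ≤ d := by
      rw [Tensor.pairPow, ← Finset.sum_sub_distrib]
      calc _ ≤ ∑ i : Fin d → Fin p, |A i * ∏ j, x (i j) - (∏ j, y (i j)) * A i| :=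
            Finset.abs_sum_le_sum_abs _ _
        _ ≤ ∑ _i : Fin d → Fin p, (d : ℝ) * (1 / (p ^ d : ℕ)) := by
            refine Finset.sum_le_sum fun i _ => ?_
            rw [mul_comm _ (A i), ← mul_sub, abs_mul, hA.abs, one_mul]
            refine (abs_prod_sub_prod_le _ _ _ (fun j => hx1 _)
              fun j => (hk1 _).trans (hx1 _)).trans ?_
            refine (Finset.sum_le_sum fun j _ => hk2 (i j)).trans ?_
            simp
        _ = d := by
            have : (p : ℝ) ≠ 0 := by positivity
            simp
            field_simp
    have h2 := abs_sub_abs_le_abs_sub (A.pairPow x) (∑ i : Fin d → Fin p, (∏ j, y (i j)) * A i)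
    linarith

-- Union bound over the grid points in the unit ball and over both signs of the pairing.
open Classical in
theorem baseSign_pairPow_tail {d p : ℕ} (hp : 0 < p) {δ : ℝ} (h0 : 0 ≤ δ) (h1 : δ ≤ 1)
    {t : ℝ} (ht : 0 ≤ t) :
    prodAvg (flagWeight δ) (fun ω : (Fin d → Fin p) → Bool × Bool =>
        if ∃ x : EuclideanSpace ℝ (Fin p), ‖x‖ = 1 ∧
          t + d ≤ |Tensor.pairPow (baseSign ω) x| then 1 else 0) ≤
      (2 * p ^ d + 1) ^ p * (2 * Real.exp (-(t ^ 2 / 2))) := by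
  let c : (Fin p → Fin (2 * p ^ d + 1)) → (Fin d → Fin p) → ℝ :=
    fun k i => ∏ j, gridPoint (p ^ d) (k (i j))
  let net := Finset.univ.filter fun k : Fin p → Fin (2 * p ^ d + 1) =>
    ∑ j, gridPoint (p ^ d) (k j) ^ 2 ≤ 1
  have h2 : ∀ ω : (Fin d → Fin p) → Bool × Bool,
      (if ∃ x : EuclideanSpace ℝ (Fin p), ‖x‖ = 1 ∧
          t + d ≤ |Tensor.pairPow (baseSign ω) x| then (1 : ℝ) else 0) ≤
        ∑ k ∈ net, ((if t ≤ ∑ i, c k i * baseSign ω i then 1 else 0) +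
          (if t ≤ ∑ i, (-c k i) * baseSign ω i then 1 else 0)) := by
    intro ω
    have hnn : ∀ k ∈ net, (0 : ℝ) ≤ (if t ≤ ∑ i, c k i * baseSign ω i then 1 else 0) +
          (if t ≤ ∑ i, (-c k i) * baseSign ω i then 1 else 0) := fun k _ => by positivity
    split_ifs with h
    · obtain ⟨x, hx, hxt⟩ := h
      obtain ⟨k, hk1, hk2⟩ := exists_grid_of_pairPow hp (isSign_baseSign ω) hx hxt
      have hk : k ∈ net := by simpa [net] using hk1
      refine le_trans ?_ (Finset.single_le_sum hnn hk)
      have hnn1 : (0 : ℝ) ≤ if t ≤ ∑ i, c k i * baseSign ω i then 1 else 0 := by positivity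
      have hnn2 : (0 : ℝ) ≤ if t ≤ ∑ i, (-c k i) * baseSign ω i then 1 else 0 := by positivity
      rcases le_abs.1 hk2 with h3 | h3
      · rw [if_pos h3]; linarith
      · have h4 : t ≤ ∑ i, (-c k i) * baseSign ω i := by
          simpa only [neg_mul, Finset.sum_neg_distrib] using h3
        rw [if_pos h4]; linarith
    · exact Finset.sum_nonneg hnn
  refine (prodAvg_mono (flagWeight_nonneg h0 h1) h2).trans ?_
  rw [prodAvg_sum]
  have h3 : ∀ k ∈ net, prodAvg (flagWeight δ) (fun ω : (Fin d → Fin p) → Bool × Bool =>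
      ((if t ≤ ∑ i, c k i * baseSign ω i then (1 : ℝ) else 0) +
          (if t ≤ ∑ i, (-c k i) * baseSign ω i then 1 else 0))) ≤
      2 * Real.exp (-(t ^ 2 / 2)) := by
    intro k hk
    have hk1 : ∑ i, c k i ^ 2 ≤ 1 := by
      rw [sum_sq_prod fun j => gridPoint (p ^ d) (k j)]
      exact pow_le_one₀ (Finset.sum_nonneg fun _ _ => sq_nonneg _) (by simpa [net] using hk)
    rw [prodAvg_add]
    have h4 := baseSign_tail h0 h1 (c k) hk1 ht
    have h5 := baseSign_tail h0 h1 (fun i => -c k i) (by simpa only [neg_sq] using hk1) ht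
    linarith
  refine (Finset.sum_le_sum h3).trans ?_
  rw [Finset.sum_const, nsmul_eq_mul]
  refine mul_le_mul_of_nonneg_right ?_ (by positivity)
  have h6 : net.card ≤ (2 * p ^ d + 1) ^ p := by
    refine (Finset.card_le_univ net).trans ?_
    simp
  exact_mod_cast h6

/-! ### Symmetrization -/

/-- The average of a tensor over all permutations of its indices. -/
noncomputable def Tensor.symmetrize {d p : ℕ} (A : Tensor d p) : Tensor d p :=
  fun i => (d.factorial : ℝ)⁻¹ * ∑ π : Equiv.Perm (Fin d), A fun j => i (π j)

theorem Tensor.isSymmetric_symmetrize {d p : ℕ} (A : Tensor d p) : A.symmetrize.IsSymmetric := by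
  intro π i
  simp only [Tensor.symmetrize]
  congr 1
  exact Fintype.sum_equiv (Equiv.mulLeft π) _ _ fun σ => rfl

/-- The tensor `x^{⊗ d}` is itself symmetric. Thus the probabilistic argument can use tensors with
fully independent entries and symmetrize only at the end. -/
theorem Tensor.pairPow_symmetrize {d p : ℕ} (A : Tensor d p) (x : EuclideanSpace ℝ (Fin p)) :
    A.symmetrize.pairPow x = A.pairPow x := by
  have h1 : ∀ π : Equiv.Perm (Fin d),
      ∑ i : Fin d → Fin p, A (fun j => i (π j)) * ∏ j, x (i j) = A.pairPow x := by
    intro π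
    refine Fintype.sum_equiv (π.symm.arrowCongr (Equiv.refl _)) _ _ fun i => ?_
    congr 1
    exact (Equiv.prod_comp π fun j => x (i j)).symm
  simp only [Tensor.pairPow, Tensor.symmetrize, mul_assoc, Finset.sum_mul]
  rw [← Finset.mul_sum, Finset.sum_comm]
  simp only [h1, Finset.sum_const, Finset.card_univ, Fintype.card_perm, Fintype.card_fin,
    nsmul_eq_mul]
  rw [inv_mul_cancel_left₀ (by positivity)]
  rfl

/-- Exhibits the entries as linear forms, so that composing a polynomial with symmetrization does
not raise its degree. -/
theorem Tensor.symmetrize_linear {d p : ℕ} (A : Tensor d p) :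
    A.symmetrize = fun i => ∑ k, ((d.factorial : ℝ)⁻¹ *
      ∑ π : Equiv.Perm (Fin d), if k = (fun j => i (π j)) then 1 else 0) * A k := by
  funext i
  simp only [Tensor.symmetrize, mul_assoc, Finset.sum_mul, ite_mul, one_mul, zero_mul]
  rw [← Finset.mul_sum, Finset.sum_comm]
  simp

theorem Tensor.abs_pairPow_le {d p : ℕ} (T : Tensor d p) {x : EuclideanSpace ℝ (Fin p)}
    (hx : ‖x‖ = 1) : |T.pairPow x| ≤ ∑ i, |T i| := by
  refine (Finset.abs_sum_le_sum_abs _ _).trans (Finset.sum_le_sum fun i _ => ?_)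
  rw [abs_mul, Finset.abs_prod]
  refine mul_le_of_le_one_right (abs_nonneg _)
    (Finset.prod_le_one (fun _ _ => abs_nonneg _) fun j _ => ?_)
  rw [← hx]
  exact PiLp.norm_apply_le x (i j)

theorem Tensor.abs_pairPow_le_specNorm {d p : ℕ} (T : Tensor d p)
    {x : EuclideanSpace ℝ (Fin p)} (hx : ‖x‖ = 1) : |T.pairPow x| ≤ T.specNorm := by
  refine le_ciSup (f := fun x : Metric.sphere (0 : EuclideanSpace ℝ (Fin p)) 1 =>
    |T.pairPow (x : EuclideanSpace ℝ (Fin p))|) ⟨∑ i, |T i|, ?_⟩ ⟨x, by simpa using hx⟩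
  rintro _ ⟨y, rfl⟩
  exact T.abs_pairPow_le (by simp)

theorem Tensor.specNorm_le {d p : ℕ} (T : Tensor d p) {a : ℝ} (ha : 0 ≤ a)
    (h : ∀ x : EuclideanSpace ℝ (Fin p), ‖x‖ = 1 → |T.pairPow x| ≤ a) : T.specNorm ≤ a :=
  Real.iSup_le (fun x => h _ (by simp)) ha

/-- The unit vector proportional to a sign vector. -/
noncomputable def unitSign {p : ℕ} (x : Fin p → Bool) : EuclideanSpace ℝ (Fin p) :=
  WithLp.toLp 2 fun j => (Real.sqrt p)⁻¹ * boolSign (x j)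

theorem norm_unitSign {p : ℕ} (hp : 0 < p) (x : Fin p → Bool) : ‖unitSign x‖ = 1 := by
  have hp' : (p : ℝ) ≠ 0 := by positivity
  have h1 : ‖unitSign x‖ ^ 2 = 1 := by
    rw [EuclideanSpace.real_norm_sq_eq]
    have h2 : ∀ j, boolSign (x j) ^ 2 = 1 := fun j => by
      rcases boolSign_eq (x j) with h | h <;> simp [h]
    simp [unitSign, mul_pow, h2, hp']
  exact (pow_eq_one_iff_of_nonneg (norm_nonneg _) two_ne_zero).1 h1

theorem pairPow_unitSign {d p : ℕ} (A : Tensor d p) (x : Fin p → Bool) :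
    A.pairPow (unitSign x) = (Real.sqrt p ^ d)⁻¹ * ∑ i, rankOneSign x i * A i := by
  rw [Tensor.pairPow, Finset.mul_sum]
  refine Finset.sum_congr rfl fun i _ => ?_
  simp [unitSign, rankOneSign, Finset.prod_mul_distrib]
  ring

theorem lt_pairPow_unitSign {d p : ℕ} (hp : 0 < p) {A : Tensor d p} {x : Fin p → Bool} {δ : ℝ}
    (h : δ * p ^ d / 2 < ∑ i, rankOneSign x i * A i) :
    δ * Real.sqrt p ^ d / 2 < |A.pairPow (unitSign x)| := by
  refine lt_of_lt_of_le ?_ (le_abs_self _)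
  have hs : 0 < Real.sqrt p := Real.sqrt_pos.2 (by exact_mod_cast hp)
  have hp2 : (p : ℝ) ^ d = Real.sqrt p ^ d * Real.sqrt p ^ d := by
    rw [← mul_pow, Real.mul_self_sqrt (by positivity)]
  rw [pairPow_unitSign, inv_mul_eq_div, lt_div_iff₀ (by positivity)]
  rw [hp2] at h
  linarith

/-! ### The moment condition and the failure of separation. -/

/-- Sets of size `k` contribute at most `4 · 16^{-k}`, and the geometric series sums to less than
`4/15`. -/
theorem sum_plantMoment_weighted_le {d p D : ℕ} (hp : 0 < p) {β : ℝ} (hβ : 0 ≤ β)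
    (h : β * (d * D) ^ d * Real.sqrt p ^ d ≤ 1 / 16) :
    ∑ U with U ≠ ∅ ∧ U.card ≤ D,
      β ^ U.card * plantMoment (rankOneSign : (Fin p → Bool) → (Fin d → Fin p) → ℝ) U ≤ 1 / 3 := by
  classical
  have h1 : (Finset.univ.filter fun U : Finset (Fin d → Fin p) => U ≠ ∅ ∧ U.card ≤ D) =
      (Finset.range D).biUnion fun k => Finset.powersetCard (k + 1) Finset.univ := by
    ext U
    simp only [Finset.mem_filter, Finset.mem_univ, true_and, Finset.mem_biUnion, Finset.mem_range,
      Finset.mem_powersetCard, Finset.subset_univ]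
    rw [← Finset.card_pos.trans Finset.nonempty_iff_ne_empty]
    constructor
    · intro hU
      exact ⟨U.card - 1, by omega, by omega⟩
    · rintro ⟨k, hk, hU⟩
      omega
  have hdisj : Set.PairwiseDisjoint ((Finset.range D : Finset ℕ) : Set ℕ) fun k =>
      Finset.powersetCard (k + 1) (Finset.univ : Finset (Fin d → Fin p)) := by
    intro a _ b _ hab
    exact Finset.pairwise_disjoint_powersetCard _ (by simpa using hab)
  rw [h1, Finset.sum_biUnion hdisj]
  have h2 : ∀ k ∈ Finset.range D, ∑ U ∈ Finset.powersetCard (k + 1) Finset.univ,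
      β ^ U.card * plantMoment (rankOneSign : (Fin p → Bool) → (Fin d → Fin p) → ℝ) U ≤
        4 * (1 / 16) ^ (k + 1) := by
    intro k hk
    have hkD : k + 1 ≤ D := Finset.mem_range.1 hk
    have h3 : ∑ U ∈ Finset.powersetCard (k + 1) Finset.univ,
        β ^ U.card * plantMoment (rankOneSign : (Fin p → Bool) → (Fin d → Fin p) → ℝ) U =
        β ^ (k + 1) * ∑ U ∈ Finset.powersetCard (k + 1) Finset.univ,
          plantMoment (rankOneSign : (Fin p → Bool) → (Fin d → Fin p) → ℝ) U := by
      rw [Finset.mul_sum]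
      exact Finset.sum_congr rfl fun U hU => by rw [(Finset.mem_powersetCard.1 hU).2]
    have h4 := (sum_plantMoment_le (d := d) (p := p) (k + 1)).trans
      (prodAvg_abs_pow_le hp (d * (k + 1)))
    have h5 : ((d * (k + 1)).factorial : ℝ) ≤ ((d * D) ^ d : ℝ) ^ (k + 1) := by
      have h6 : (d * (k + 1)).factorial ≤ (d * D) ^ (d * (k + 1)) :=
        (Nat.factorial_le_pow _).trans (Nat.pow_le_pow_left (Nat.mul_le_mul_left d hkD) _)
      rw [← pow_mul]
      exact_mod_cast h6
    rw [h3]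
    calc _ ≤ β ^ (k + 1) *
          (4 * ((d * (k + 1)).factorial : ℝ) * Real.sqrt p ^ (d * (k + 1))) := by gcongr
      _ ≤ β ^ (k + 1) * (4 * ((d * D) ^ d : ℝ) ^ (k + 1) * Real.sqrt p ^ (d * (k + 1))) := by
          gcongr
      _ = 4 * (β * (d * D) ^ d * Real.sqrt p ^ d) ^ (k + 1) := by
          rw [pow_mul, mul_pow, mul_pow]; ring
      _ ≤ 4 * (1 / 16) ^ (k + 1) := by gcongr
  refine (Finset.sum_le_sum h2).trans ?_
  have h7 : ∀ n : ℕ, ∑ k ∈ Finset.range n, 4 * (1 / 16 : ℝ) ^ (k + 1) =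
      4 / 15 * (1 - (1 / 16) ^ n) := by
    intro n
    induction n with
    | zero => simp
    | succ n ih => rw [Finset.sum_range_succ, ih]; ring
  rw [h7]
  have : (0 : ℝ) ≤ (1 / 16) ^ D := by positivity
  linarith

open Classical in
/-- A polynomial of low degree does not separate random sign tensors of small spectral norm from
planted ones of large spectral norm. -/
theorem not_separates {d p D : ℕ} (hp : 0 < p) {δ t : ℝ} (hδ0 : 0 < δ) (hδ1 : δ ≤ 1)
    (ht : 0 ≤ t) (hδD : δ * D ≤ 1 / 4)
    (hmom : 4 * (D + 1) * δ ^ 2 * (d * D) ^ d * Real.sqrt p ^ d ≤ 1 / 16)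
    (htail : ((p : ℝ) ^ d + 1) ^ D * ((2 * p ^ d + 1) ^ p * (2 * Real.exp (-(t ^ 2 / 2))) +
      Real.exp (-(p ^ d * δ ^ 2 / 16))) < 1 / 4)
    (P : MvPolynomial (Fin d → Fin p) ℝ) (hP : P.totalDegree ≤ D) :
    ∃ A B : Tensor d p, (∀ x, ‖x‖ = 1 → |A.pairPow x| ≤ t + d) ∧
      (∃ x, ‖x‖ = 1 ∧ δ * Real.sqrt p ^ d / 2 < |B.pairPow x|) ∧
      MvPolynomial.eval B.symmetrize P ≤ MvPolynomial.eval A.symmetrize P := by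
  by_contra! hsep
  let badBase : ((Fin d → Fin p) → Bool × Bool) → Prop := fun ω =>
    ∃ x : EuclideanSpace ℝ (Fin p), ‖x‖ = 1 ∧ t + d ≤ |Tensor.pairPow (baseSign ω) x|
  let s : (Fin p → Bool) → (Fin d → Fin p) → ℝ := rankOneSign
  let badPlant : (Fin p → Bool) → ((Fin d → Fin p) → Bool × Bool) → Prop := fun x ω =>
    ∑ i, s x i * plantSign (s x) ω i ≤ δ * Fintype.card (Fin d → Fin p) / 2
  have hcard : (Fintype.card (Fin d → Fin p) : ℝ) = (p : ℝ) ^ d := by simp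
  set ε1 := (2 * (p : ℝ) ^ d + 1) ^ p * (2 * Real.exp (-(t ^ 2 / 2))) with hε1
  set ε2 := Real.exp (-(p ^ d * δ ^ 2 / 16)) with hε2
  set N := ((p : ℝ) ^ d + 1) ^ D with hN
  have hN1 : 1 ≤ N := one_le_pow₀ (by have : (0 : ℝ) ≤ p ^ d := by positivity
                                      linarith)
  have htail1 := baseSign_pairPow_tail (d := d) hp hδ0.le hδ1 ht
  have htail2 := fun x : Fin p → Bool => plantSign_tail hδ0.le hδ1
    (isSign_rankOneSign (d := d) x)
  rw [hcard] at htail2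
  have hε1nn : 0 ≤ ε1 := by positivity
  have hε2nn : 0 ≤ ε2 := by positivity
  have hgood : ∃ ω, ¬ badBase ω := by
    by_contra! hall
    have h1 : prodAvg (flagWeight δ)
        (fun ω : (Fin d → Fin p) → Bool × Bool => if badBase ω then (1 : ℝ) else 0) = 1 := by
      simp only [hall, if_true]
      exact prodAvg_const (sum_flagWeight δ) 1
    have h2 : (1 : ℝ) ≤ ε1 := h1 ▸ htail1
    nlinarith
  -- The threshold is the largest value of `P` on a good base tensor; being attained, it lies
  -- strictly below every value on a tensor of large norm.
  obtain ⟨ω₀, hω₀, hmax⟩ := Finset.exists_max_image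
    (Finset.univ.filter fun ω => ¬ badBase ω)
    (fun ω => MvPolynomial.eval (Tensor.symmetrize (baseSign ω)) P)
    (by obtain ⟨ω, hω⟩ := hgood; exact ⟨ω, by simpa using hω⟩)
  set τ := MvPolynomial.eval (Tensor.symmetrize (baseSign ω₀)) P with hτ
  have hlow : IsLowDegreeOnSigns D
      (fun v : Tensor d p => MvPolynomial.eval v.symmetrize P + -τ) := by
    simp only [Tensor.symmetrize_linear]
    exact (isLowDegreeOnSigns_eval P hP _).add (isLowDegreeOnSigns_const _)
  obtain ⟨q, hq, hqe⟩ := hlow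
  have hle : ∀ ω, ¬ badBase ω → multilin q (baseSign ω) ≤ 0 := by
    intro ω hω
    rw [← hqe _ (isSign_baseSign ω)]
    have := hmax ω (by simpa using hω)
    linarith
  have hbase : ∀ x, ‖x‖ = 1 → |Tensor.pairPow (baseSign ω₀) x| ≤ t + d := by
    have h1 : ¬ badBase ω₀ := by simpa using hω₀
    intro x hx
    by_contra! h2
    exact h1 ⟨x, hx, h2.le⟩
  have hpos : ∀ (B : Tensor d p) (x : Fin p → Bool), IsSign B →
      δ * (p : ℝ) ^ d / 2 < ∑ i, s x i * B i → 0 < multilin q B := by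
    intro B x hB hx
    rw [← hqe _ hB]
    have := hsep (baseSign ω₀) B hbase ⟨unitSign x, norm_unitSign hp x, lt_pairPow_unitSign hp hx⟩
    linarith
  -- The final contradiction needs `q ≠ 0`. The all-ones tensor has large norm, so `q` is positive
  -- there.
  have hq0 : 0 < ∑ S, q S ^ 2 := by
    have h1 : 0 < multilin q (s fun _ => true) := by
      refine hpos _ (fun _ => true) (isSign_rankOneSign _) ?_
      simp only [(isSign_rankOneSign (d := d) fun _ : Fin p => true).mul_self, s,
        Finset.sum_const, Finset.card_univ, nsmul_eq_mul, hcard, mul_one]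
      have : (0 : ℝ) < p ^ d := by positivity
      nlinarith
    by_contra! h2
    have h3 := (Finset.sum_eq_zero_iff_of_nonneg fun S _ => sq_nonneg (q S)).1
      (le_antisymm h2 (Finset.sum_nonneg fun S _ => sq_nonneg (q S)))
    have h4 : multilin q (s fun _ => true) = 0 :=
      Finset.sum_eq_zero fun S hS => by rw [pow_eq_zero_iff two_ne_zero |>.1 (h3 S hS), zero_mul]
    linarith
  set R := ∑ S, q S ^ 2
  have hlower : 1 / 4 * R ≤ prodAvg coinWeight (fun x => prodAvg (flagWeight δ) fun ω =>
        multilin q (baseSign ω) * multilin q (plantSign (s x) ω)) := by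
    rw [correlation_eq]
    have hD : (0 : ℝ) < 4 * (D + 1) := by positivity
    -- This `α` makes `δ / α = 1 / (4 (D + 1))`, so `(1 + δ / α)^D ≤ e^{1/4} ≤ 4/3`, and `δ α = 4 (D
    -- + 1) δ²`, the weight in `hmom`.
    refine correlation_ge (D := D) (α := 4 * (D + 1) * δ) hδ0.le hδ1 (by positivity)
      (fun U => (prodAvg_rankOneSign_mem_Icc U fun i => i).1)
      (fun U => (prodAvg_rankOneSign_mem_Icc U fun i => i).2) plantMoment_empty hq hδD ?_ ?_
    · have h1 : δ / (4 * (D + 1) * δ) = 1 / (4 * (D + 1)) := by field_simp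
      rw [h1]
      calc (1 + 1 / (4 * ((D : ℝ) + 1))) ^ D ≤ Real.exp (1 / (4 * ((D : ℝ) + 1))) ^ D := by
            gcongr
            linarith [Real.add_one_le_exp (1 / (4 * ((D : ℝ) + 1)))]
        _ = Real.exp (D * (1 / (4 * ((D : ℝ) + 1)))) := by rw [← Real.exp_nat_mul]
        _ ≤ Real.exp (1 / 4) := by
            rw [Real.exp_le_exp, mul_one_div, div_le_iff₀ hD]; linarith
        _ ≤ 4 / 3 := by
            have h2 := Real.add_one_le_exp (-(1 / 4) : ℝ)
            have h3 : Real.exp (1 / 4) * Real.exp (-(1 / 4)) = 1 := by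
              rw [← Real.exp_add]; simp
            nlinarith [Real.exp_pos (1 / 4)]
    · refine sum_plantMoment_weighted_le hp (by positivity) (le_trans (le_of_eq ?_) hmom)
      ring
  have hupper : prodAvg coinWeight (fun x => prodAvg (flagWeight δ) fun ω =>
        multilin q (baseSign ω) * multilin q (plantSign (s x) ω)) ≤ N * R * (ε1 + ε2) := by
    have hNR : 0 ≤ N * R := by positivity
    have h1 : ∀ x, prodAvg (flagWeight δ) (fun ω =>
        multilin q (baseSign ω) * multilin q (plantSign (s x) ω)) ≤ N * R * (ε1 + ε2) := by
      intro x
      have h2 : ∀ ω, multilin q (baseSign ω) * multilin q (plantSign (s x) ω) ≤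
          N * R * ((if badBase ω then 1 else 0) + if badPlant x ω then 1 else 0) := by
        intro ω
        have hsx : IsSign (plantSign (s x) ω) := isSign_plantSign (isSign_rankOneSign x) ω
        have h3 : multilin q (baseSign ω) * multilin q (plantSign (s x) ω) ≤ N * R := by
          refine (le_abs_self _).trans ?_
          rw [abs_mul]
          have := multilin_sq_le q hq (isSign_baseSign ω) hsx
          rwa [hcard] at this
        by_cases hb : badBase ω
        · by_cases hb' : badPlant x ω
          · rw [if_pos hb, if_pos hb']; linarith
          · rw [if_pos hb, if_neg hb']; linarith
        · by_cases hb' : badPlant x ω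
          · rw [if_neg hb, if_pos hb']; linarith
          · rw [if_neg hb, if_neg hb', add_zero, mul_zero]
            refine mul_nonpos_of_nonpos_of_nonneg (hle ω hb) (hpos _ x hsx ?_).le
            rw [← hcard]
            exact not_le.1 hb'
      refine (prodAvg_mono (flagWeight_nonneg hδ0.le hδ1) h2).trans ?_
      rw [prodAvg_const_mul, prodAvg_add]
      refine mul_le_mul_of_nonneg_left (add_le_add htail1 ?_) hNR
      have := htail2 x
      simpa only [badPlant, hcard] using this
    refine (prodAvg_mono coinWeight_nonneg h1).trans ?_
    rw [prodAvg_const sum_coinWeight]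
  -- `R / 4 ≤ N R (ε1 + ε2) < R / 4`, since `R > 0`.
  nlinarith

/-! ### Distortion -/

theorem one_le_distortion {d p : ℕ} {f : Tensor d p → ℝ≥0} {γ : ℝ}
    (hf : IsTwoSidedApprox f γ ∨ IsLowerCertificate f γ ∨ IsUpperCertificate f γ) : 1 ≤ γ := by
  rcases hf with ⟨ρ, ζ, hρ, hζ, rfl, -⟩ | ⟨h, -⟩ | ⟨h, -⟩
  · exact one_le_mul_of_one_le_of_one_le hρ hζ
  · exact h
  · exact h

theorem specNorm_le_distortion_mul {d p : ℕ} {f : Tensor d p → ℝ≥0} {γ : ℝ}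
    (hf : IsTwoSidedApprox f γ ∨ IsLowerCertificate f γ ∨ IsUpperCertificate f γ)
    {S T : Tensor d p} (hS : S.IsSymmetric) (hT : T.IsSymmetric) (hTS : f T ≤ f S) :
    T.specNorm ≤ γ * S.specNorm := by
  have h0 : (f T : ℝ) ≤ f S := by exact_mod_cast hTS
  rcases hf with ⟨ρ, ζ, hρ, hζ, rfl, h⟩ | ⟨hγ, h⟩ | ⟨hγ, h⟩
  · have h1 := (h T hT).1.trans (h0.trans (h S hS).2)
    rwa [inv_mul_le_iff₀ (by linarith), ← mul_assoc] at h1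
  · have h1 := (h T hT).1.trans (h0.trans (h S hS).2)
    rwa [inv_mul_le_iff₀ (by linarith)] at h1
  · exact (h T hT).1.trans (h0.trans (h S hS).2)

/-! ### Choice of parameters. -/

/-- Here `s` stands for `p^{d/4}`. The sup-bound factor costs `exp(2dL³)` and the net `exp(2dpL)`,
against tails `exp(-8d²pL²)` for the base and `exp(-s² / polylog)` for the plant; `s² ≥ p` makes the
latter small enough. -/
theorem tail_budget {d p D : ℕ} {L s δ t : ℝ} (hd : 3 ≤ d) (hp : 3 ≤ p) (hL : L = Real.log p)
    (hL1 : 1 ≤ L) (hD : (D : ℝ) ≤ L ^ 2) (hs0 : 0 < s) (hs : s ^ 4 = (p : ℝ) ^ d)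
    (hps : (p : ℝ) ≤ s ^ 2)
    (hLp : 11520 * (d : ℝ) ^ (2 * d + 1) * L ^ (2 * d + 5) ≤ p)
    (hδ : δ = 1 / (12 * d ^ d * L ^ (d + 1) * s)) (ht : t = 4 * d * Real.sqrt p * L) :
    ((p : ℝ) ^ d + 1) ^ D * ((2 * p ^ d + 1) ^ p * (2 * Real.exp (-(t ^ 2 / 2))) +
      Real.exp (-(p ^ d * δ ^ 2 / 16))) < 1 / 4 := by
  have hd' : (3 : ℝ) ≤ d := by exact_mod_cast hd
  have hp' : (3 : ℝ) ≤ p := by exact_mod_cast hp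
  have hpe : (p : ℝ) ^ (d + 1) = Real.exp ((d + 1) * L) := by
    rw [hL, mul_comm, Real.exp_mul, Real.exp_log (by linarith)]
    exact_mod_cast (Real.rpow_natCast (p : ℝ) (d + 1)).symm
  have hpd : (1 : ℝ) ≤ p ^ d := one_le_pow₀ (by linarith)
  have h1 : (p : ℝ) ^ d + 1 ≤ Real.exp ((d + 1) * L) := by
    rw [← hpe, pow_succ]; nlinarith
  have h2 : 2 * (p : ℝ) ^ d + 1 ≤ Real.exp ((d + 1) * L) := by
    rw [← hpe, pow_succ]; nlinarith
  have h3 : ((p : ℝ) ^ d + 1) ^ D ≤ Real.exp (2 * d * L ^ 3) := by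
    calc ((p : ℝ) ^ d + 1) ^ D ≤ Real.exp ((d + 1) * L) ^ D := by gcongr
      _ = Real.exp (D * ((d + 1) * L)) := by rw [← Real.exp_nat_mul]
      _ ≤ Real.exp (2 * d * L ^ 3) := by
          rw [Real.exp_le_exp]
          calc (D : ℝ) * ((d + 1) * L) ≤ L ^ 2 * ((2 * d) * L) := by gcongr; linarith
            _ = _ := by ring
  have h4 : (2 * (p : ℝ) ^ d + 1) ^ p ≤ Real.exp (2 * d * p * L) := by
    calc (2 * (p : ℝ) ^ d + 1) ^ p ≤ Real.exp ((d + 1) * L) ^ p := by gcongr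
      _ = Real.exp (p * ((d + 1) * L)) := by rw [← Real.exp_nat_mul]
      _ ≤ Real.exp (2 * d * p * L) := by
          rw [Real.exp_le_exp]
          calc (p : ℝ) * ((d + 1) * L) ≤ p * ((2 * d) * L) := by gcongr; linarith
            _ = _ := by ring
  have ht2 : t ^ 2 / 2 = 8 * d ^ 2 * p * L ^ 2 := by
    rw [ht]
    have := Real.sq_sqrt (show (0 : ℝ) ≤ p by linarith)
    calc (4 * d * Real.sqrt p * L) ^ 2 / 2 = 8 * d ^ 2 * (Real.sqrt p) ^ 2 * L ^ 2 := by ring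
      _ = _ := by rw [this]
  have hL2p : L ^ 2 ≤ p := by
    refine le_trans ?_ hLp
    have h5 : L ^ 2 ≤ L ^ (2 * d + 5) := pow_le_pow_right₀ hL1 (by omega)
    have h6 : (1 : ℝ) ≤ (d : ℝ) ^ (2 * d + 1) := one_le_pow₀ (by linarith)
    nlinarith [pow_nonneg (zero_le_one.trans hL1) (2 * d + 5)]
  have hL2 : 1 ≤ L ^ 2 := one_le_pow₀ hL1
  have hA : 2 * d * L ^ 3 + 2 * d * p * L - t ^ 2 / 2 ≤ -3 := by
    rw [ht2]
    have h5 : 2 * d * L ^ 3 ≤ 2 * d * p * L := by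
      calc 2 * d * L ^ 3 = 2 * d * L ^ 2 * L := by ring
        _ ≤ 2 * d * p * L := by gcongr
    have h6 : 2 * d * p * L ≤ 2 * (d : ℝ) * p * L ^ 2 := by
      have : L ≤ L ^ 2 := by nlinarith
      gcongr
    have h7 : 9 ≤ (d : ℝ) * p := by nlinarith
    have h8 : 9 ≤ (d : ℝ) * p * L ^ 2 := by nlinarith
    have h9 : 3 * (d * p * L ^ 2) ≤ (d : ℝ) * (d * p * L ^ 2) :=
      mul_le_mul_of_nonneg_right hd' (by positivity)
    nlinarith
  have hB : 2 * d * L ^ 3 - p ^ d * δ ^ 2 / 16 ≤ -3 := by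
    have h5 : (p : ℝ) ^ d * δ ^ 2 / 16 = s ^ 2 / (2304 * d ^ (2 * d) * L ^ (2 * d + 2)) := by
      rw [hδ, ← hs]
      have : (d : ℝ) ≠ 0 := by positivity
      have : L ≠ 0 := by positivity
      field_simp
      ring
    -- The constant `11520 = 5 · 2304` in `hLp` is what this needs, with `2304 = 16 · 12²` coming
    -- from `δ`.
    have h6 : 5 * d * L ^ 3 ≤ p ^ d * δ ^ 2 / 16 := by
      rw [h5, le_div_iff₀ (by positivity)]
      refine le_trans (le_of_eq ?_) (hLp.trans hps)
      ring
    have h7 : 1 ≤ L ^ 3 := one_le_pow₀ hL1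
    nlinarith
  have he3 : Real.exp (-3) < 1 / 12 := by
    have h5 : Real.exp 1 ^ 3 = Real.exp 3 := by rw [← Real.exp_nat_mul]; norm_num
    have h6 : (12 : ℝ) < Real.exp 3 := by
      rw [← h5]
      calc (12 : ℝ) < 2.5 ^ 3 := by norm_num
        _ ≤ Real.exp 1 ^ 3 := by gcongr; linarith [Real.exp_one_gt_d9]
    rw [Real.exp_neg, inv_eq_one_div]
    exact one_div_lt_one_div_of_lt (by norm_num) h6
  calc ((p : ℝ) ^ d + 1) ^ D * ((2 * p ^ d + 1) ^ p * (2 * Real.exp (-(t ^ 2 / 2))) +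
      Real.exp (-(p ^ d * δ ^ 2 / 16)))
      ≤ Real.exp (2 * d * L ^ 3) * (Real.exp (2 * d * p * L) * (2 * Real.exp (-(t ^ 2 / 2))) +
      Real.exp (-(p ^ d * δ ^ 2 / 16))) := by gcongr
    _ = 2 * Real.exp (2 * d * L ^ 3 + 2 * d * p * L - t ^ 2 / 2) +
        Real.exp (2 * d * L ^ 3 - p ^ d * δ ^ 2 / 16) := by
        simp only [sub_eq_add_neg, Real.exp_add]; ring
    _ ≤ 2 * Real.exp (-3) + Real.exp (-3) :=
        add_le_add (mul_le_mul_of_nonneg_left (Real.exp_le_exp.2 hA) zero_le_two)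
          (Real.exp_le_exp.2 hB)
    _ < 1 / 4 := by linarith

theorem distortion_ge {d p D : ℕ} (hd : 3 ≤ d) (hp : 3 ≤ p)
    (hL1 : 1 ≤ Real.log p) (hD : (D : ℝ) ≤ Real.log p ^ 2)
    (hLp : 11520 * (d : ℝ) ^ (2 * d + 1) * Real.log p ^ (2 * d + 5) ≤ p)
    {f : Tensor d p → ℝ≥0} (hfD : IsLowDegreeAlgorithm D f) {γ : ℝ}
    (hf : IsTwoSidedApprox f γ ∨ IsLowerCertificate f γ ∨ IsUpperCertificate f γ) :
    (p : ℝ) ^ ((d : ℝ) / 4 - 1 / 2) ≤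
      120 * d ^ (d + 1) * Real.log p ^ (d + 2) * γ := by
  obtain ⟨P, hP, φ, hφ, hfP⟩ := hfD
  set L := Real.log p with hL
  set s : ℝ := (p : ℝ) ^ ((d : ℝ) / 4) with hsdef
  have hp0 : (0 : ℝ) < p := by positivity
  have hp1 : (1 : ℝ) ≤ p := by exact_mod_cast (by omega : 1 ≤ p)
  have hd1 : (1 : ℝ) ≤ d := by exact_mod_cast (by omega : 1 ≤ d)
  have hs0 : 0 < s := Real.rpow_pos_of_pos hp0 _
  have hs1 : 1 ≤ s := Real.one_le_rpow hp1 (by positivity)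
  have hs4 : s ^ 4 = (p : ℝ) ^ d := by
    rw [hsdef, ← Real.rpow_natCast, ← Real.rpow_mul hp0.le, ← Real.rpow_natCast]
    congr 1; push_cast; ring
  have hs2 : s ^ 2 = Real.sqrt p ^ d := by
    rw [hsdef, Real.sqrt_eq_rpow, ← Real.rpow_natCast, ← Real.rpow_natCast, ← Real.rpow_mul hp0.le,
      ← Real.rpow_mul hp0.le]
    congr 1; push_cast; ring
  have hps : (p : ℝ) ≤ s ^ 2 := by
    have h1 : (1 : ℝ) ≤ (d : ℝ) / 4 * (2 : ℕ) := by
      have : (3 : ℝ) ≤ d := by exact_mod_cast hd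
      push_cast; linarith
    rw [hsdef, ← Real.rpow_natCast, ← Real.rpow_mul hp0.le]
    calc (p : ℝ) = p ^ (1 : ℝ) := (Real.rpow_one _).symm
      _ ≤ _ := Real.rpow_le_rpow_of_exponent_le hp1 h1
  -- Up to constants, the largest `δ` allowed by the moment condition when `D ≤ L²`: the left side
  -- of `hmom` is then at most `8 / 144`.
  set δ := 1 / (12 * (d : ℝ) ^ d * L ^ (d + 1) * s) with hδ
  set t := 4 * d * Real.sqrt p * L with ht
  have hL0 : 0 < L := by linarith
  have hdd : (1 : ℝ) ≤ (d : ℝ) ^ d := one_le_pow₀ hd1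
  have hLd : L ^ 2 ≤ L ^ (d + 1) := pow_le_pow_right₀ hL1 (by omega)
  have hden : 12 * L ^ 2 ≤ 12 * (d : ℝ) ^ d * L ^ (d + 1) * s := by
    calc 12 * L ^ 2 = 12 * 1 * L ^ 2 * 1 := by ring
      _ ≤ _ := by gcongr
  have hδL : δ ≤ 1 / (12 * L ^ 2) := one_div_le_one_div_of_le (by positivity) hden
  have hL2 : 1 ≤ L ^ 2 := one_le_pow₀ hL1
  have hδ0 : 0 < δ := by positivity
  have hδ1 : δ ≤ 1 := hδL.trans (by rw [div_le_one (by positivity)]; linarith)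
  have hδD : δ * D ≤ 1 / 4 := by
    calc δ * D ≤ 1 / (12 * L ^ 2) * L ^ 2 := by gcongr
      _ = 1 / 12 := by field_simp
      _ ≤ 1 / 4 := by norm_num
  have hmom : 4 * (D + 1) * δ ^ 2 * (d * D) ^ d * Real.sqrt p ^ d ≤ 1 / 16 := by
    rw [← hs2]
    calc 4 * ((D : ℝ) + 1) * δ ^ 2 * (d * D) ^ d * s ^ 2
        ≤ 4 * (2 * L ^ 2) * δ ^ 2 * ((d : ℝ) * L ^ 2) ^ d * s ^ 2 := by gcongr; linarith
      _ = 8 / 144 / (d : ℝ) ^ d := by rw [hδ, mul_pow]; field_simp; ring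
      _ ≤ 8 / 144 / 1 := by gcongr
      _ ≤ 1 / 16 := by norm_num
  obtain ⟨A, B, hA, ⟨x, hx, hB⟩, hAB⟩ := not_separates (by omega) hδ0 hδ1 (t := t) (by positivity)
    hδD hmom (tail_budget hd hp hL hL1 hD hs0 hs4 hps hLp hδ ht) P hP
  have h1 := specNorm_le_distortion_mul hf A.isSymmetric_symmetrize B.isSymmetric_symmetrize
    (by rw [hfP, hfP]; exact hφ hAB)
  have hsp : 1 ≤ Real.sqrt p := Real.one_le_sqrt.2 hp1
  have h2 : A.symmetrize.specNorm ≤ 5 * d * Real.sqrt p * L := by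
    refine Tensor.specNorm_le _ (by positivity) fun x hx => ?_
    rw [Tensor.pairPow_symmetrize]
    refine (hA x hx).trans ?_
    have : (d : ℝ) * 1 * 1 ≤ d * Real.sqrt p * L := by gcongr
    rw [ht]; linarith
  have h3 : δ * s ^ 2 / 2 ≤ B.symmetrize.specNorm := by
    refine le_trans ?_ (B.symmetrize.abs_pairPow_le_specNorm hx)
    rw [Tensor.pairPow_symmetrize, hs2]
    exact hB.le
  have hγ : 1 ≤ γ := one_le_distortion hf
  have h4 : δ * s ^ 2 / 2 ≤ γ * (5 * d * Real.sqrt p * L) :=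
    h3.trans (h1.trans (mul_le_mul_of_nonneg_left h2 (by linarith)))
  -- Comparing `s / (24 d^d L^{d+1})` with `γ · 5 d √p L` yields the constant `120 = 24 · 5` and the
  -- power `d + 2` of the logarithm.
  have h5 : δ * s ^ 2 / 2 = s / (24 * d ^ d * L ^ (d + 1)) := by
    rw [hδ]; field_simp; ring
  rw [h5, div_le_iff₀ (by positivity)] at h4
  rw [Real.rpow_sub hp0, ← hsdef, ← Real.sqrt_eq_rpow, div_le_iff₀ (by positivity)]
  refine h4.trans (le_of_eq ?_)
  ring

theorem eventually_log_pow_le (a : ℝ) (n : ℕ) :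
    ∀ᶠ p : ℕ in Filter.atTop, a * Real.log p ^ n ≤ p := by
  have h1 := ((Real.isLittleO_pow_log_id_atTop (n := n)).const_mul_left a).comp_tendsto
    tendsto_natCast_atTop_atTop (α := ℝ)
  filter_upwards [h1.bound one_pos] with p hp
  simp only [Function.comp_apply, id_eq, one_mul, Real.norm_eq_abs, Nat.abs_cast] at hp
  exact (le_abs_self _).trans hp

theorem theorem2 (d : ℕ) (hd : 3 ≤ d) :
    ∃ c C K : ℝ, 0 < c ∧ 0 < C ∧ 0 < K ∧
      ∀ (p : ℕ), 2 ≤ p → ∀ (D : ℕ), (D : ℝ) ≤ c * (Real.log (p : ℝ)) ^ 2 →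
        ∀ f : Tensor d p → ℝ≥0, IsLowDegreeAlgorithm D f →
          ∀ γ : ℝ, (IsTwoSidedApprox f γ ∨ IsLowerCertificate f γ ∨ IsUpperCertificate f γ) →
            K * ((p : ℝ) ^ ((d : ℝ) / 4 - 1 / 2) / (Real.log (p : ℝ)) ^ C) ≤ γ := by
  obtain ⟨p₀, hp₀⟩ := Filter.eventually_atTop.1
    (eventually_log_pow_le (11520 * (d : ℝ) ^ (2 * d + 1)) (2 * d + 5))
  set e : ℝ := (d : ℝ) / 4 - 1 / 2 with he
  have hd' : (3 : ℝ) ≤ d := by exact_mod_cast hd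
  have he0 : 0 ≤ e := by linarith
  -- Below `p₀ + 3` the bound is made trivial by shrinking `K` and using `γ ≥ 1`; the `3` ensures
  -- `log p ≥ 1` above it.
  set q : ℝ := p₀ + 3 with hq
  have hlog2 : 0 < Real.log 2 := Real.log_pos one_lt_two
  have hqe : 0 < q ^ e := Real.rpow_pos_of_pos (by positivity) _
  refine ⟨1, ((d + 2 : ℕ) : ℝ), min (1 / (120 * (d : ℝ) ^ (d + 1))) (Real.log 2 ^ (d + 2) / q ^ e),
    one_pos, by positivity, lt_min (by positivity) (by positivity), ?_⟩
  intro p hp D hD f hfD γ hf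
  have hp2 : (2 : ℝ) ≤ p := by exact_mod_cast hp
  have hlog : Real.log 2 ≤ Real.log p := Real.log_le_log two_pos hp2
  have hLpos : 0 < Real.log p := hlog2.trans_le hlog
  rw [Real.rpow_natCast]
  have hpe : 0 ≤ (p : ℝ) ^ e / Real.log p ^ (d + 2) := by positivity
  by_cases h : p₀ + 3 ≤ p
  · have hL1 : 1 ≤ Real.log p := by
      rw [Real.le_log_iff_exp_le (by linarith)]
      have : (3 : ℝ) ≤ p := by exact_mod_cast (by omega : 3 ≤ p)
      linarith [Real.exp_one_lt_d9]
    rw [one_mul] at hD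
    have h1 := distortion_ge hd (by omega) hL1 hD (hp₀ p (by omega)) hfD hf
    calc _ ≤ 1 / (120 * (d : ℝ) ^ (d + 1)) * ((p : ℝ) ^ e / Real.log p ^ (d + 2)) :=
          mul_le_mul_of_nonneg_right (min_le_left _ _) hpe
      _ = (p : ℝ) ^ e / (120 * d ^ (d + 1) * Real.log p ^ (d + 2)) := by field_simp
      _ ≤ γ := by
          rw [div_le_iff₀ (by positivity)]
          linarith
  · have hpq : (p : ℝ) ≤ q := by
      rw [hq]; exact_mod_cast (by omega : p ≤ p₀ + 3)
    calc _ ≤ Real.log 2 ^ (d + 2) / q ^ e * ((p : ℝ) ^ e / Real.log p ^ (d + 2)) :=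
          mul_le_mul_of_nonneg_right (min_le_right _ _) hpe
      _ ≤ Real.log 2 ^ (d + 2) / q ^ e * (q ^ e / Real.log 2 ^ (d + 2)) := by gcongr
      _ = 1 := by field_simp
      _ ≤ γ := one_le_distortion hf
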